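/- **Setting.** There are $m\ge 1$ base arms. Arm $i$ has a distribution $D_i$ supported on $[0,1]$ with mean $\mu_i$; $\mu=(\mu_1,\dots,\mu_m)$. The action space $\mathcal A$ is a nonempty family of subsets of $[m]=\{1,\dots,m\}$, each of cardinality at most $k\ge 1$ (for instance all subsets of cardinality at most $k$, or of cardinality exactly $k$). In each round $t=1,\dots,T$ (with $T\ge1$) the player chooses an action $A_t\in\mathcal A$, using only information from before round $t$; independently of the past, outcomes $X_1^{(t)},\dots,X_m^{(t)}$ are drawn independently, with $X_i^{(t)}\sim D_i$. *Cascading feedback:* the arms of $A_t$ are revealed one by one, in an order fixed in advance that may depend on the round and on the action. In the *disjunctive form* the revelation stops right after the first revealed outcome equal to $1$, in the *conjunctive form* right after the first revealed outcome equal to $0$; otherwise it goes on to the end. The player observes the outcomes of the set $\tau_t\subseteq A_t$ of revealed arms. The reward of an action $A$ for a mean vector $v$ is $r(A,v)=1-\prod_{i\in A}(1-v_i)$ in the disjunctive form and $r(A,v)=\prod_{i\in A}v_i$ in the conjunctive form. With $A^*\in\operatorname{argmax}_{A\in\mathcal A}r(A,\mu)$, the expected regret is $\mathbb E[R(T)]=\mathbb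 E\big[\sum_{t=1}^T\big(r(A^*,\mu)-r(A_t,\mu)\big)\big]$. Let $p_{A,t}$ be the probability that all arms of $A$ are observed when $A$ is played in round $t$, and $p^*=\min_{1\le t\le T}\min_{A\in\mathcal A}p_{A,t}$. **Algorithm (CMOSS with parameter $\delta$).** Start with $T_i=0$ and $\hat\mu_i=1$ for every arm $i$. In each round, let $\rho_i=\sqrt{\frac1{T_i}\ln\max\{1,\frac1{\delta T_i}\}}$ (and $\rho_i=+\infty$ if $T_i=0$) and $\bar\mu_i=\min\{\hat\mu_i+\rho_i,1\}$; play an $A_t\in\operatorname{argmax}_{A\in\mathcal A}r(A,\bar\mu)$ (ties broken arbitrarily), observe $X_i^{(t)}$ for $i\in\tau_t$, and for every $i\in\tau_t$ replace first $T_i$ by $T_i+1$ and then $\hat\mu_i$ by $\hat\mu_i+(X_i^{(t)}-\hat\mu_i)/T_i$. **Theorem.** There is an absolute constant $C>0$ such that for both forms of cascading feedback and every instance as above with $p^*>0$, CMOSS with $\delta=\frac{m}{kT}$ satisfies $$\mathbb E[R(T)]\;\le\; C\,\frac{(\max\{1,\log_2 k\})^2}{p^*}\,\sqrt{kmT}.$$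 -/

import Mathlib

open MeasureTheory ProbabilityTheory

namespace Cascading

/-- The two forms of cascading feedback. -/
inductive Form
  | disjunctive
  | conjunctive

/-- The outcome whose first occurrence ends the revelation of the arms of an action:
`1` in the disjunctive form, `0` in the conjunctive form. -/
def Form.stopOutcome : Form → ℝ
  | disjunctive => 1
  | conjunctive => 0

/-- The reward `r(A, v)` of the action `A` when the arms have mean vector `v`. -/
noncomputable def reward {m : ℕ} (form : Form) (A : Finset (Fin m)) (v : Fin m → ℝ) : ℝ :=
  match form with
  | Form.disjunctive => 1 - ∏ i ∈ A, (1 - v i)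
  | Form.conjunctive => ∏ i ∈ A, v i

open Classical in
/-- The triggered set when `A` is played and the arms have outcomes `x`. The arms of `A` are
revealed one by one, by increasing position `σ i`, up to and including the first one that shows
the stopping outcome (or up to the end). Thus `i ∈ A` is revealed if and only if no arm of `A`
placed before `i` shows the stopping outcome. -/
noncomputable def triggered {m : ℕ} (form : Form) (σ : Equiv.Perm (Fin m))
    (A : Finset (Fin m)) (x : Fin m → ℝ) : Finset (Fin m) :=
  A.filter fun i => ∀ j ∈ A, σ j < σ i → x j ≠ form.stopOutcome

/-- `p_{A,t}`: the probability that all base arms of `A` are observed in round `t`, when `A` is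
played, the arms have independent outcomes with laws `D i`, and the arms of `A` are revealed
in round `t` in the order `σ t A`. -/
noncomputable def fullObservationProb {m : ℕ} (form : Form) (D : Fin m → Measure ℝ)
    (σ : ℕ → Finset (Fin m) → Equiv.Perm (Fin m)) (A : Finset (Fin m)) (t : ℕ) : ℝ :=
  (Measure.pi D).real {x | triggered form (σ t A) A x = A}

/-- `p*`: the minimum of `p_{A,t}` over the rounds `t < T` and the actions `A ∈ 𝒜`
(a minimum over a finite set, nonempty as soon as `1 ≤ T` and `𝒜` is nonempty). -/
noncomputable def pStar {m : ℕ} (form : Form) (D : Fin m → Measure ℝ)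
    (σ : ℕ → Finset (Fin m) → Equiv.Perm (Fin m)) (𝒜 : Finset (Finset (Fin m))) (T : ℕ) : ℝ :=
  ⨅ q : Fin T × {A : Finset (Fin m) // A ∈ 𝒜},
    fullObservationProb form D σ q.2.1 q.1

/-- The mean rewards of the arms. -/
noncomputable def means {m : ℕ} (D : Fin m → Measure ℝ) (i : Fin m) : ℝ := ∫ y, y ∂(D i)

/-- The memory of the algorithm: the number of observations `T_i` and the empirical mean
`μ̂_i` of every arm. -/
structure ArmStats (m : ℕ) where
  count : Fin m → ℕ
  mean : Fin m → ℝ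

/-- The update of the memory after the outcomes `x i`, `i ∈ τ`, have been observed. -/
noncomputable def ArmStats.update {m : ℕ} (S : ArmStats m) (τ : Finset (Fin m))
    (x : Fin m → ℝ) : ArmStats m where
  count i := if i ∈ τ then S.count i + 1 else S.count i
  mean i := if i ∈ τ then S.mean i + (x i - S.mean i) / ((S.count i + 1 : ℕ) : ℝ) else S.mean i

/-- The memory at the beginning of round `t` (rounds are `0, 1, 2, …`) when the actions
`A 0, A 1, …` are played and the arms have outcomes `x 0, x 1, …`. -/
noncomputable def stats {m : ℕ} (form : Form) (σ : ℕ → Finset (Fin m) → Equiv.Perm (Fin m))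
    (A : ℕ → Finset (Fin m)) (x : ℕ → Fin m → ℝ) : ℕ → ArmStats m
  | 0 => { count := fun _ => 0, mean := fun _ => 1 }
  | t + 1 => (stats form σ A x t).update (triggered form (σ t (A t)) (A t) (x t)) (x t)

/-- The optimistic estimates `μ̄_i = min {μ̂_i + ρ_i, 1}`, with
`ρ_i = √(ln⁺(1 / (δ T_i)) / T_i)`, `ln⁺ y = ln (max 1 y)`, and `ρ_i = +∞` if `T_i = 0`. -/
noncomputable def ucb {m : ℕ} (δ : ℝ) (S : ArmStats m) (i : Fin m) : ℝ :=
  if S.count i = 0 then 1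
  else min (S.mean i +
    Real.sqrt (1 / (S.count i : ℝ) * Real.log (max 1 (1 / (δ * (S.count i : ℝ)))))) 1

/-- Over `T` rounds, on the probability space `(Ω, P)`, the processes `X` (outcomes of all the
arms) and `A` (actions) are the interaction of the CMOSS algorithm with parameter `δ` and action
space `𝒜` with the cascading environment with arm distributions `D` and revelation orders `σ`.

Here `ℱ t` is the information available before round `t`. An arbitrary (possibly
history-dependent or randomized) choice among the maximizers is allowed: it is only required that
the action is chosen before the outcomes of the round are drawn. -/
structure IsCMOSSRun {m : ℕ} {Ω : Type*} [mΩ : MeasurableSpace Ω] (P : Measure Ω)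
    (form : Form) (D : Fin m → Measure ℝ) (σ : ℕ → Finset (Fin m) → Equiv.Perm (Fin m))
    (𝒜 : Finset (Finset (Fin m))) (δ : ℝ) (T : ℕ) (ℱ : Filtration ℕ mΩ)
    (X : ℕ → Ω → Fin m → ℝ) (A : ℕ → Ω → Finset (Fin m)) : Prop where
  /-- the action of round `t` is known before round `t` -/
  measurable_action : ∀ t < T, ∀ B : Finset (Fin m), MeasurableSet[ℱ t] {ω | A t ω = B}
  /-- the outcomes of round `t` are drawn before round `t + 1` -/
  measurable_outcome : ∀ t < T, Measurable[ℱ (t + 1)] (X t)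
  /-- the outcomes of round `t` are independent of the past -/
  indep_past : ∀ t < T, Indep (MeasurableSpace.comap (X t) inferInstance) (ℱ t) P
  /-- in every round the arms are independent, and arm `i` has law `D i` -/
  law_outcome : ∀ t < T, P.map (X t) = Measure.pi D
  /-- the action of round `t` belongs to the action space -/
  action_mem : ∀ t < T, ∀ ω, A t ω ∈ 𝒜
  /-- the action of round `t` maximizes `r(·, μ̄)` over the action space -/
  action_argmax : ∀ t < T, ∀ ω, IsMaxOn
    (fun B => reward form B
      (ucb δ (stats form σ (fun s => A s ω) (fun s => X s ω) t))) ↑𝒜 (A t ω)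

/-- The expected regret `E[∑_t (r(A*, μ) - r(A_t, μ))]` over `T` rounds. -/
noncomputable def expectedRegret {m : ℕ} {Ω : Type*} [MeasurableSpace Ω] (P : Measure Ω)
    (form : Form) (D : Fin m → Measure ℝ) (T : ℕ) (Astar : Finset (Fin m))
    (A : ℕ → Ω → Finset (Fin m)) : ℝ :=
  ∫ ω, ∑ t ∈ Finset.range T,
    (reward form Astar (means D) - reward form (A t ω) (means D)) ∂P

end Cascading

/-! The argument is of MOSS type and gives the bound `654 / p* · √(kmT)`; the logarithmic factor of
the theorem is at least `1` and is only inserted at the very end.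

Since the reward is monotone and `1`-Lipschitz in `ℓ¹`, and the played action is optimal for the
optimistic means, the regret of a round is at most the underestimation of the means of the arms of
`A*` plus the overestimation of the means of the arms of `A_t`. Both are controlled through one
supermartingale per arm, `exp (l M - l² N / 8)`, where `N` counts observations and `M` is the
centered observed sum. It exists because whether an arm is revealed depends neither on its own
outcome nor on the future (`lintegral_exp_triggered_le`); conditioning is expressed by integrating
against nonnegative weights measurable in the past.

Underestimation must be bounded in every round, so the worst excess over the whole run is needed.
Peeling over dyadic blocks of the count, with a maximal inequality in each block, gives an
expectation of order `√δ` (`exists_excess_le`). Over `T` rounds and at most `k` arms this is `kT√δ`.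

Overestimation is charged to observations: given the past, a played arm is revealed with probability
at least `p*`, which costs the factor `1 / p*` (`pStar_mul_lintegral_le`). At observation times the
count takes each value once, so the radii and the deviations beyond `√δ` sum to order `1 / √δ` per
arm, while the remaining `√δ` per observation totals at most `kT√δ`
(`sum_lintegral_overestimation_le`). For `δ = m / (kT)` both `kT√δ` and `m / √δ` equal `√(kmT)`. -/

namespace Cascading

/-! ### Exponential supermartingale of a single arm. -/

/-- `N t` counts the observations of an arm before round `t`, and `M t` is the sum of these
observations minus their means. The exponential moments are those of centered variables with
values in an interval of length `1`. -/
structure IsCenteredSum {Ω : Type*} [mΩ : MeasurableSpace Ω] (P : Measure Ω)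
    (ℱ : Filtration ℕ mΩ) (T : ℕ) (N : ℕ → Ω → ℕ) (M : ℕ → Ω → ℝ) : Prop where
  count_zero : ∀ ω, N 0 ω = 0
  sum_zero : ∀ ω, M 0 ω = 0
  measurable_count : ∀ t ≤ T, Measurable[ℱ t] (N t)
  measurable_sum : ∀ t ≤ T, Measurable[ℱ t] (M t)
  step : ∀ t < T, ∀ ω, (N (t + 1) ω = N t ω ∧ M (t + 1) ω = M t ω) ∨ N (t + 1) ω = N t ω + 1
  exp_step : ∀ l : ℝ, ∀ t < T, ∀ g : Ω → ENNReal, Measurable[ℱ t] g →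
    ∫⁻ ω, g ω * ENNReal.ofReal (Real.exp (l * (M (t + 1) ω - M t ω)
      - l ^ 2 / 8 * ((N (t + 1) ω : ℝ) - N t ω))) ∂P ≤ ∫⁻ ω, g ω ∂P

namespace IsCenteredSum

section

variable {Ω : Type*} {N : ℕ → Ω → ℕ} {M : ℕ → Ω → ℝ}

/-- The logarithm of the exponential supermartingale. -/
noncomputable def logExp (N : ℕ → Ω → ℕ) (M : ℕ → Ω → ℝ) (l : ℝ) (t : ℕ) (ω : Ω) : ℝ :=
  l * M t ω - l ^ 2 / 8 * N t ω

theorem exp_logExp_succ (l : ℝ) (t : ℕ) (ω : Ω) :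
    Real.exp (logExp N M l (t + 1) ω) = Real.exp (logExp N M l t ω) *
      Real.exp (l * (M (t + 1) ω - M t ω) - l ^ 2 / 8 * ((N (t + 1) ω : ℝ) - N t ω)) := by
  rw [← Real.exp_add]; congr 1; simp only [logExp]; ring

theorem logExp_step_eq (l : ℝ) (t : ℕ) (ω : Ω)
    (h : N (t + 1) ω = N t ω ∧ M (t + 1) ω = M t ω) :
    logExp N M l (t + 1) ω = logExp N M l t ω := by
  simp [logExp, h]

/-- The maximum of `0` and of the values of a process at the times `1, …, t`. -/
noncomputable def runningMax (θ : ℕ → Ω → ℝ) : ℕ → Ω → ℝ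
  | 0, _ => 0
  | t + 1, ω => max (runningMax θ t ω) (θ (t + 1) ω)

theorem le_runningMax {θ : ℕ → Ω → ℝ} (h0 : ∀ ω, θ 0 ω = 0) (T t : ℕ) (ht : t ≤ T) (ω : Ω) :
    θ t ω ≤ runningMax θ T ω := by
  induction T with
  | zero => obtain rfl : t = 0 := by omega
            simp [runningMax, h0]
  | succ T ih =>
    rcases Nat.lt_or_ge T t with h | h
    · obtain rfl : t = T + 1 := by omega
      exact le_max_right _ _
    · exact (ih h).trans (le_max_left _ _)

end

variable {Ω : Type*} [mΩ : MeasurableSpace Ω] {P : Measure Ω} {ℱ : Filtration ℕ mΩ} {T : ℕ}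
  {N : ℕ → Ω → ℕ} {M : ℕ → Ω → ℝ}

theorem neg (h : IsCenteredSum P ℱ T N M) : IsCenteredSum P ℱ T N (fun t ω => - M t ω) where
  count_zero := h.count_zero
  sum_zero ω := by simp [h.sum_zero]
  measurable_count := h.measurable_count
  measurable_sum t ht := (h.measurable_sum t ht).neg
  step t ht ω := by rcases h.step t ht ω with h | h <;> simp [h]
  exp_step l t ht g hg := by
    refine le_trans (le_of_eq ?_) (h.exp_step (-l) t ht g hg)
    congr 1; ext ω; congr 3; ring

theorem count_le (h : IsCenteredSum P ℱ T N M) (t : ℕ) (ht : t ≤ T) (ω : Ω) : N t ω ≤ t := by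
  induction t with
  | zero => simp [h.count_zero]
  | succ t ih =>
    have := ih (by omega)
    rcases h.step t (by omega) ω with h | h <;> omega

/-- A sum over the rounds with an observation is a sum over the number of observations. -/
theorem sum_observed_eq (h : IsCenteredSum P ℱ T N M) (f : ℕ → ENNReal) (t : ℕ) (ht : t ≤ T)
    (ω : Ω) : ∑ u ∈ Finset.range t, (if N (u + 1) ω = N u ω + 1 then f (N u ω) else 0)
      = ∑ s ∈ Finset.range (N t ω), f s := by
  induction t with
  | zero => simp [h.count_zero]
  | succ t ih =>
    rw [Finset.sum_range_succ, ih (by omega)]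
    rcases h.step t (by omega) ω with h | h
    · simp [h.1]
    · simp [h, Finset.sum_range_succ]

theorem measurable_logExp (h : IsCenteredSum P ℱ T N M) (l : ℝ) (t : ℕ) (ht : t ≤ T) :
    Measurable[ℱ t] (logExp N M l t) := by
  have h1 := h.measurable_sum t ht
  have h2 : Measurable[ℱ t] fun ω => (N t ω : ℝ) :=
    (measurable_from_top (f := fun n : ℕ => (n : ℝ))).comp (h.measurable_count t ht)
  exact (h1.const_mul _).sub (h2.const_mul _)

theorem logExp_zero (h : IsCenteredSum P ℱ T N M) (l : ℝ) (ω : Ω) : logExp N M l 0 ω = 0 := by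
  simp [logExp, h.count_zero, h.sum_zero]

/-! ### Deviations at observation times. -/

/-- Optional stopping at the observation that follows the `s`-th one. -/
theorem lintegral_sum_exp_logExp_le [IsProbabilityMeasure P] (h : IsCenteredSum P ℱ T N M)
    (l : ℝ) (s : ℕ) (t : ℕ) (ht : t ≤ T) :
    ∫⁻ ω, (if N t ω ≤ s then ENNReal.ofReal (Real.exp (logExp N M l t ω)) else 0) +
      ∑ u ∈ Finset.range t, (if N u ω = s ∧ N (u + 1) ω = N u ω + 1 then
        ENNReal.ofReal (Real.exp (logExp N M l u ω)) else 0) ∂P ≤ 1 := by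
  induction t with
  | zero => simp [h.count_zero, h.logExp_zero]
  | succ t ih =>
    refine le_trans ?_ (ih (by omega))
    have hW : ∀ u ≤ T, Measurable[ℱ u] fun ω => ENNReal.ofReal (Real.exp (logExp N M l u ω)) :=
      fun u hu => (Real.measurable_exp.comp (h.measurable_logExp l u hu)).ennreal_ofReal
    have hN : ∀ u ≤ T, Measurable (N u) := fun u hu => (h.measurable_count u hu).mono (ℱ.le u) le_rfl
    -- `R` is the mass that can no longer change: already stopped, or waiting at count `s` (the
    -- process is frozen just before the next observation). Only `g`, the mass with count below `s`,
    -- still evolves and needs the supermartingale property.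
    set R : Ω → ENNReal := fun ω =>
      (if N t ω = s then ENNReal.ofReal (Real.exp (logExp N M l t ω)) else 0) +
      ∑ u ∈ Finset.range t, (if N u ω = s ∧ N (u + 1) ω = N u ω + 1 then
        ENNReal.ofReal (Real.exp (logExp N M l u ω)) else 0) with hR
    set g : Ω → ENNReal := fun ω =>
      if N t ω < s then ENNReal.ofReal (Real.exp (logExp N M l t ω)) else 0 with hg
    have hRm : Measurable R := by
      refine Measurable.add (Measurable.ite ?_ ((hW t (by omega)).mono (ℱ.le t) le_rfl)
        measurable_const) (Finset.measurable_sum _ fun u hu => ?_)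
      · exact hN t (by omega) (measurableSet_singleton s)
      · have hu' := Finset.mem_range.1 hu
        refine Measurable.ite ?_ ((hW u (by omega)).mono (ℱ.le u) le_rfl) measurable_const
        exact (hN u (by omega) (measurableSet_singleton s)).inter
          (measurableSet_eq_fun (hN (u + 1) (by omega)) ((hN u (by omega)).add_const 1))
    have hgm : Measurable[ℱ t] g :=
      Measurable.ite (h.measurable_count t (by omega) (measurableSet_Iio (a := s)))
        (hW t (by omega)) measurable_const
    calc _ ≤ ∫⁻ ω, R ω + g ω * ENNReal.ofReal (Real.exp (l * (M (t + 1) ω - M t ω)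
          - l ^ 2 / 8 * ((N (t + 1) ω : ℝ) - N t ω))) ∂P := by
          refine lintegral_mono fun ω => ?_
          simp only [hR, hg, Finset.sum_range_succ]
          rcases lt_trichotomy (N t ω) s with hs | hs | hs
          · have h1 : N (t + 1) ω ≤ s := by rcases h.step t (by omega) ω with h | h <;> omega
            rw [if_pos h1, if_neg (by omega), if_neg (by omega), if_pos hs, exp_logExp_succ,
              ENNReal.ofReal_mul (Real.exp_pos _).le]
            simp [add_comm]
          · rcases h.step t (by omega) ω with h1 | h1
            · rw [logExp_step_eq l t ω h1]; simp [h1.1, hs]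
            · simp [h1, hs, add_comm]
          · have h1 : ¬ N (t + 1) ω ≤ s := by rcases h.step t (by omega) ω with h | h <;> omega
            rw [if_neg h1, if_neg (by omega : ¬ (N t ω = s ∧ _)), if_neg (by omega : ¬ N t ω = s)]
            simp
      _ = ∫⁻ ω, R ω ∂P + ∫⁻ ω, g ω * ENNReal.ofReal (Real.exp (l * (M (t + 1) ω - M t ω)
          - l ^ 2 / 8 * ((N (t + 1) ω : ℝ) - N t ω))) ∂P := lintegral_add_left hRm _
      _ ≤ ∫⁻ ω, R ω ∂P + ∫⁻ ω, g ω ∂P := by exact add_le_add le_rfl (h.exp_step l t (by omega) g hgm)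
      _ = ∫⁻ ω, R ω + g ω ∂P := (lintegral_add_left hRm _).symm
      _ ≤ _ := by
          refine lintegral_mono fun ω => ?_
          simp only [hR, hg]
          rcases lt_trichotomy (N t ω) s with hs | hs | hs
          · simp [hs, hs.le, hs.ne, add_comm]
          · simp [hs]
          · simp [hs.ne', hs.not_gt, hs.not_ge]

theorem pos_part_le_exp {a : ℝ} (ha : 0 < a) (z : ℝ) : max z 0 ≤ Real.exp (a * z) / a := by
  rw [le_div_iff₀ ha]
  rcases le_total z 0 with h | h
  · simp [h, (Real.exp_pos _).le]
  · rw [max_eq_left h]; linarith [Real.add_one_le_exp (a * z)]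

/-- The overestimation of the mean at the times of an observation. -/
theorem lintegral_sum_excess_of_count_eq_le [IsProbabilityMeasure P] (h : IsCenteredSum P ℱ T N M)
    {ε : ℝ} (s : ℕ) (hs : 1 ≤ s) :
    ∫⁻ ω, ∑ u ∈ Finset.range T, (if N u ω = s ∧ N (u + 1) ω = N u ω + 1 then
        ENNReal.ofReal (M u ω / N u ω - ε) else 0) ∂P
      ≤ ENNReal.ofReal (2 * (1 / Real.sqrt s * Real.exp (-ε * Real.sqrt s))) := by
  have hs0 : (0 : ℝ) < s := by exact_mod_cast hs
  have hq : 0 < Real.sqrt s := Real.sqrt_pos.2 hs0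
  have hqq : Real.sqrt s ^ 2 = s := Real.sq_sqrt hs0.le
  set q := Real.sqrt s with hqdef
  -- With `l = 1 / √s` the compensator at count `s` is the constant `1 / 8`, whose exponential is
  -- absorbed in the factor `2`.
  have key := h.lintegral_sum_exp_logExp_le (1 / q) s T le_rfl
  calc _ ≤ ∫⁻ ω, ENNReal.ofReal (2 * (1 / q * Real.exp (-ε * q))) *
        ((if N T ω ≤ s then ENNReal.ofReal (Real.exp (logExp N M (1 / q) T ω)) else 0) +
      ∑ u ∈ Finset.range T, (if N u ω = s ∧ N (u + 1) ω = N u ω + 1 then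
        ENNReal.ofReal (Real.exp (logExp N M (1 / q) u ω)) else 0)) ∂P := by
        refine lintegral_mono fun ω => ?_
        refine le_trans ?_ (mul_le_mul_right (le_add_left le_rfl) _)
        rw [Finset.mul_sum]
        refine Finset.sum_le_sum fun u _ => ?_
        split_ifs with hu
        · rw [← ENNReal.ofReal_mul (by positivity)]
          refine ENNReal.ofReal_le_ofReal ((le_max_left _ 0).trans
            ((pos_part_le_exp hq _).trans ?_))
          have e1 : q * (M u ω / N u ω - ε) = 1 / 8 + (-ε * q + logExp N M (1 / q) u ω) := by
            simp only [logExp, hu.1]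
            rw [← hqq]; field_simp; ring
          rw [e1, Real.exp_add, Real.exp_add]
          have e2 : Real.exp (1 / 8) ≤ 2 := by
            have := Real.exp_bound_div_one_sub_of_interval (x := 1 / 8) (by norm_num) (by norm_num)
            linarith
          have : 0 < Real.exp (-ε * q) * Real.exp (logExp N M (1 / q) u ω) := by positivity
          rw [div_le_iff₀ hq]
          calc _ ≤ 2 * (Real.exp (-ε * q) * Real.exp (logExp N M (1 / q) u ω)) := by gcongr
            _ = _ := by field_simp
        · simp
    _ ≤ ENNReal.ofReal (2 * (1 / q * Real.exp (-ε * q))) * 1 := by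
        rw [lintegral_const_mul' _ _ ENNReal.ofReal_ne_top]
        gcongr
    _ = _ := mul_one _

/-- Comparison with the integral of `exp (-ε √x) / √x`, through `√(s+1) - √s ≥ 1 / (2 √(s+1))`; the
right-hand side telescopes. -/
theorem exp_neg_sqrt_le {ε : ℝ} (hε : 0 < ε) (s : ℕ) :
    1 / Real.sqrt (s + 1 : ℕ) * Real.exp (-ε * Real.sqrt (s + 1 : ℕ)) ≤
      2 / ε * (Real.exp (-ε * Real.sqrt s) - Real.exp (-ε * Real.sqrt (s + 1 : ℕ))) := by
  have h0 : (0 : ℝ) ≤ s := Nat.cast_nonneg s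
  have ha : 0 ≤ Real.sqrt s := Real.sqrt_nonneg _
  have hb : 0 < Real.sqrt (s + 1 : ℕ) := Real.sqrt_pos.2 (by positivity)
  have ha2 : Real.sqrt s ^ 2 = s := Real.sq_sqrt h0
  have hb2 : Real.sqrt (s + 1 : ℕ) ^ 2 = s + 1 := by rw [Real.sq_sqrt (by positivity)]; simp
  set a := Real.sqrt s
  set b := Real.sqrt (s + 1 : ℕ)
  have hab : a ≤ b := by nlinarith
  have h1 : ε * (b - a) + 1 ≤ Real.exp (ε * (b - a)) := Real.add_one_le_exp _
  have h2 : Real.exp (-ε * a) = Real.exp (-ε * b) * Real.exp (ε * (b - a)) := by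
    rw [← Real.exp_add]; congr 1; ring
  have h3 : 1 ≤ 2 * b * (b - a) := by nlinarith
  have hE := Real.exp_pos (-ε * b)
  rw [h2]
  have h4 : 1 / b ≤ 2 / ε * (ε * (b - a)) := by
    rw [div_le_iff₀ hb]; field_simp; nlinarith
  calc _ ≤ 2 / ε * (ε * (b - a)) * Real.exp (-ε * b) := by gcongr
    _ = 2 / ε * (Real.exp (-ε * b) * (ε * (b - a))) := by ring
    _ ≤ 2 / ε * (Real.exp (-ε * b) * (Real.exp (ε * (b - a)) - 1)) := by gcongr; linarith
    _ = _ := by ring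

/-- Each value of the count is left by at most one observation, so the sum over rounds is split by
counts `s + 1`, and no maximal inequality is needed. -/
theorem lintegral_sum_excess_le [IsProbabilityMeasure P] (h : IsCenteredSum P ℱ T N M)
    {ε : ℝ} (hε : 0 < ε) :
    ∫⁻ ω, ∑ u ∈ Finset.range T, (if 1 ≤ N u ω ∧ N (u + 1) ω = N u ω + 1 then
        ENNReal.ofReal (M u ω / N u ω - ε) else 0) ∂P ≤ ENNReal.ofReal (4 / ε) := by
  have hN : ∀ u ≤ T, Measurable (N u) := fun u hu => (h.measurable_count u hu).mono (ℱ.le u) le_rfl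
  have hM : ∀ u ≤ T, Measurable (M u) := fun u hu => (h.measurable_sum u hu).mono (ℱ.le u) le_rfl
  have hNr : ∀ u ≤ T, Measurable fun ω => (N u ω : ℝ) := fun u hu =>
    (measurable_from_top (f := fun n : ℕ => (n : ℝ))).comp (hN u hu)
  calc _ ≤ ∫⁻ ω, ∑ s ∈ Finset.range T, ∑ u ∈ Finset.range T,
        (if N u ω = s + 1 ∧ N (u + 1) ω = N u ω + 1 then
        ENNReal.ofReal (M u ω / N u ω - ε) else 0) ∂P := by
        refine lintegral_mono fun ω => ?_
        rw [Finset.sum_comm]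
        refine Finset.sum_le_sum fun u hu => ?_
        split_ifs with h1
        · have h2 := h.count_le u (Finset.mem_range.1 hu).le ω
          have h3 := Finset.mem_range.1 hu
          refine le_trans ?_ (Finset.single_le_sum (f := fun s => if N u ω = s + 1 ∧
            N (u + 1) ω = N u ω + 1 then ENNReal.ofReal (M u ω / N u ω - ε) else 0)
            (fun _ _ => zero_le) (Finset.mem_range.2 (by omega : N u ω - 1 < T)))
          have h4 : N u ω = N u ω - 1 + 1 := by omega
          simp only [if_pos (And.intro h4 h1.2)]; exact le_rfl
        · exact zero_le
    _ = ∑ s ∈ Finset.range T, ∫⁻ ω, ∑ u ∈ Finset.range T,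
        (if N u ω = s + 1 ∧ N (u + 1) ω = N u ω + 1 then
        ENNReal.ofReal (M u ω / N u ω - ε) else 0) ∂P := by
        refine lintegral_finsetSum _ fun s _ => Finset.measurable_sum _ fun u hu => ?_
        have hu' := Finset.mem_range.1 hu
        refine Measurable.ite ?_ (((hM u hu'.le).div (hNr u hu'.le)).sub_const _).ennreal_ofReal
          measurable_const
        exact (hN u (by omega) (measurableSet_singleton (s + 1))).inter
          (measurableSet_eq_fun (hN (u + 1) (by omega)) ((hN u (by omega)).add_const 1))
    _ ≤ ∑ s ∈ Finset.range T, ENNReal.ofReal (4 / ε * (Real.exp (-ε * Real.sqrt s)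
          - Real.exp (-ε * Real.sqrt (s + 1 : ℕ)))) := by
        refine Finset.sum_le_sum fun s _ =>
          (h.lintegral_sum_excess_of_count_eq_le (s + 1) (by omega)).trans
            (ENNReal.ofReal_le_ofReal ?_)
        have := exp_neg_sqrt_le hε s
        calc _ ≤ 2 * (2 / ε * (Real.exp (-ε * Real.sqrt s)
          - Real.exp (-ε * Real.sqrt (s + 1 : ℕ)))) := by gcongr
          _ = _ := by ring
    _ = ENNReal.ofReal (∑ s ∈ Finset.range T, 4 / ε * (Real.exp (-ε * Real.sqrt s)
          - Real.exp (-ε * Real.sqrt (s + 1 : ℕ)))) := by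
        refine (ENNReal.ofReal_sum_of_nonneg fun s _ => ?_).symm
        refine mul_nonneg (by positivity) (sub_nonneg.2 (Real.exp_le_exp.2 ?_))
        have : Real.sqrt s ≤ Real.sqrt (s + 1 : ℕ) := Real.sqrt_le_sqrt (by simp)
        nlinarith
    _ ≤ _ := by
        refine ENNReal.ofReal_le_ofReal ?_
        rw [← Finset.mul_sum, Finset.sum_range_sub' (fun s : ℕ => Real.exp (-ε * Real.sqrt s))]
        have := Real.exp_pos (-ε * Real.sqrt T)
        have h4 : 0 < 4 / ε := by positivity
        simp only [Nat.cast_zero, Real.sqrt_zero, mul_zero, Real.exp_zero]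
        nlinarith

/-! ### Maximal inequality. -/

theorem measurable_runningMax (h : IsCenteredSum P ℱ T N M) (l : ℝ) (t : ℕ) (ht : t ≤ T) :
    Measurable[ℱ t] (runningMax (logExp N M l) t) := by
  induction t with
  | zero => exact measurable_const
  | succ t ih =>
    exact ((ih (by omega)).mono (ℱ.mono (Nat.le_succ t)) le_rfl).max (h.measurable_logExp l _ ht)

/-- With `u = exp (x / 4)` and `v = exp (g / 4)` this is `4 u³ v ≤ 3 u⁴ + v⁴`. It handles the steps
at which the running maximum increases. -/
theorem four_exp_le (x g : ℝ) :
    4 * Real.exp (3 / 4 * x) ≤ 3 * Real.exp (x - g / 4) + Real.exp (3 / 4 * g) := by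
  have hu := Real.exp_pos (x / 4)
  have hv := Real.exp_pos (g / 4)
  have e1 : Real.exp (3 / 4 * x) = Real.exp (x / 4) ^ 3 := by
    rw [← Real.exp_nat_mul]; congr 1; push_cast; ring
  have e2 : Real.exp (3 / 4 * g) = Real.exp (g / 4) ^ 3 := by
    rw [← Real.exp_nat_mul]; congr 1; push_cast; ring
  have e3 : Real.exp (x - g / 4) = Real.exp (x / 4) ^ 4 / Real.exp (g / 4) := by
    rw [← Real.exp_nat_mul, ← Real.exp_sub]; congr 1; push_cast; ring
  rw [e1, e2, e3]
  set u := Real.exp (x / 4)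
  set v := Real.exp (g / 4)
  rw [← sub_nonneg]
  have : 3 * (u ^ 4 / v) + v ^ 3 - 4 * u ^ 3
      = (u - v) ^ 2 * (2 * u ^ 2 + (u + v) ^ 2) / v := by field_simp; ring
  rw [this]; positivity

/-- A maximal inequality for the exponential supermartingale. -/
theorem lintegral_exp_runningMax_le [IsProbabilityMeasure P] (h : IsCenteredSum P ℱ T N M)
    (l : ℝ) : ∫⁻ ω, ENNReal.ofReal (Real.exp (3 / 4 * runningMax (logExp N M l) T ω)) ∂P ≤ 4 := by
  set θ := logExp N M l with hθ
  set G := runningMax θ with hG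
  -- The potential `exp (3G/4) + 3 exp (θ - G/4)` starts at `4` and its expectation does not
  -- increase. An exponent below `1` keeps this moment of the maximum bounded; one above `1/2` is
  -- needed later to sum the dyadic blocks.
  suffices H : ∀ t ≤ T, ∫⁻ ω, ENNReal.ofReal (Real.exp (3 / 4 * G t ω)) +
      ENNReal.ofReal (3 * Real.exp (θ t ω - G t ω / 4)) ∂P ≤ 4 from
    (lintegral_mono fun ω => le_self_add).trans (H T le_rfl)
  intro t ht
  induction t with
  | zero =>
    simp only [hG, runningMax, hθ, h.logExp_zero]
    simp only [mul_zero, zero_div, sub_zero, Real.exp_zero, lintegral_const, measure_univ, mul_one]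
    norm_num
  | succ t ih =>
    refine le_trans ?_ (ih (by omega))
    have hGm : Measurable[ℱ t] (G t) := h.measurable_runningMax l t (by omega)
    have hθm : Measurable[ℱ t] (θ t) := h.measurable_logExp l t (by omega)
    have hgm : Measurable[ℱ t] fun ω => ENNReal.ofReal (3 * Real.exp (θ t ω - G t ω / 4)) :=
      ((Real.measurable_exp.comp (hθm.sub (hGm.div_const 4))).const_mul 3).ennreal_ofReal
    have hRm : Measurable fun ω => ENNReal.ofReal (Real.exp (3 / 4 * G t ω)) :=
      ((Real.measurable_exp.comp (hGm.const_mul _)).ennreal_ofReal).mono (ℱ.le t) le_rfl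
    rw [lintegral_add_left hRm]
    refine le_trans ?_ (add_le_add_right (h.exp_step l t (by omega) _ hgm) _)
    rw [← lintegral_add_left hRm]
    refine lintegral_mono fun ω => ?_
    simp only
    rw [← ENNReal.ofReal_mul (by positivity), ← ENNReal.ofReal_add (by positivity) (by positivity),
      ← ENNReal.ofReal_add (by positivity) (by positivity)]
    refine ENNReal.ofReal_le_ofReal ?_
    have e : 3 * Real.exp (θ t ω - G t ω / 4) * Real.exp (l * (M (t + 1) ω - M t ω)
        - l ^ 2 / 8 * ((N (t + 1) ω : ℝ) - N t ω))
        = 3 * Real.exp (θ (t + 1) ω - G t ω / 4) := by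
      rw [sub_eq_add_neg (θ (t + 1) ω), Real.exp_add, exp_logExp_succ, sub_eq_add_neg (θ t ω),
        Real.exp_add]
      ring
    rw [e]
    have hs : G (t + 1) ω = max (G t ω) (θ (t + 1) ω) := rfl
    rcases le_total (θ (t + 1) ω) (G t ω) with hc | hc
    · rw [hs, max_eq_left hc]
    · rw [hs, max_eq_right hc]
      have := four_exp_le (θ (t + 1) ω) (G t ω)
      have e3 : θ (t + 1) ω - θ (t + 1) ω / 4 = 3 / 4 * θ (t + 1) ω := by ring
      rw [e3]; linarith

end IsCenteredSum

/-! ### Sums of radii and weights of dyadic blocks. -/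

/-- The confidence radius of the algorithm. -/
noncomputable def radius (δ : ℝ) (n : ℕ) : ℝ :=
  Real.sqrt (1 / (n : ℝ) * Real.log (max 1 (1 / (δ * (n : ℝ)))))

theorem radius_nonneg (δ : ℝ) (n : ℕ) : 0 ≤ radius δ n := Real.sqrt_nonneg _

/-- `k * radius δ k` is the root of `k` times a logarithm that decreases in `k`: take the first
factor at `n` and the logarithm at `2n`. -/
theorem sqrt_le_mul_radius {δ : ℝ} (hδ : 0 < δ) {n k : ℕ} (hn : 1 ≤ n) (h1 : n ≤ k)
    (h2 : k ≤ 2 * n) :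
    Real.sqrt (n * Real.log (max 1 (1 / (δ * (2 * n))))) ≤ k * radius δ k := by
  have hn0 : (0 : ℝ) < n := by exact_mod_cast hn
  have h1' : (n : ℝ) ≤ k := by exact_mod_cast h1
  have h2' : (k : ℝ) ≤ 2 * n := by exact_mod_cast h2
  have hk0 : (0 : ℝ) < k := by linarith
  have hL : Real.log (max 1 (1 / (δ * (2 * n)))) ≤ Real.log (max 1 (1 / (δ * k))) := by
    refine Real.log_le_log (by positivity) (max_le_max le_rfl ?_)
    exact one_div_le_one_div_of_le (by positivity) (by gcongr)
  have hL0 : 0 ≤ Real.log (max 1 (1 / (δ * k))) := Real.log_nonneg (le_max_left _ _)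
  refine Real.sqrt_le_iff.2 ⟨mul_nonneg hk0.le (radius_nonneg _ _), ?_⟩
  rw [mul_pow, radius, Real.sq_sqrt (by positivity)]
  calc _ ≤ (k : ℝ) * Real.log (max 1 (1 / (δ * k))) := mul_le_mul h1' hL
        (Real.log_nonneg (le_max_left _ _)) hk0.le
    _ = _ := by field_simp

/-- The sum of the radii, compared with a telescoping sum. -/
theorem radius_succ_le {δ : ℝ} (hδ : 0 < δ) (s : ℕ) :
    radius δ (s + 1) ≤ 8 / Real.sqrt δ * (min 1 (Real.sqrt (Real.sqrt (δ * (s + 1 : ℕ))))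
      - min 1 (Real.sqrt (Real.sqrt (δ * s)))) := by
  have hd : 0 < Real.sqrt δ := Real.sqrt_pos.2 hδ
  have hmono : Real.sqrt (Real.sqrt (δ * s)) ≤ Real.sqrt (Real.sqrt (δ * (s + 1 : ℕ))) :=
    Real.sqrt_le_sqrt (Real.sqrt_le_sqrt (by gcongr; simp))
  have hs1 : (0 : ℝ) < (s + 1 : ℕ) := by positivity
  rcases le_total 1 (δ * (s + 1 : ℕ)) with h | h
  · have : radius δ (s + 1) = 0 := by
      rw [radius, max_eq_left]
      · simp
      · rw [div_le_one (by positivity)]; exact h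
    rw [this]
    exact mul_nonneg (by positivity) (sub_nonneg.2 (min_le_min le_rfl hmono))
  · have hb1 : Real.sqrt (Real.sqrt (δ * (s + 1 : ℕ))) ≤ 1 := by
      rw [Real.sqrt_le_one, Real.sqrt_le_one]; exact h
    rw [min_eq_right hb1, min_eq_right (hmono.trans hb1)]
    have ha : 0 ≤ Real.sqrt (Real.sqrt (δ * s)) := Real.sqrt_nonneg _
    have hb : 0 < Real.sqrt (Real.sqrt (δ * (s + 1 : ℕ))) := by positivity
    have ha4 : Real.sqrt (Real.sqrt (δ * s)) ^ 4 = δ * s := by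
      rw [show 4 = 2 * 2 from rfl, pow_mul, Real.sq_sqrt (by positivity),
        Real.sq_sqrt (by positivity)]
    have hb4 : Real.sqrt (Real.sqrt (δ * (s + 1 : ℕ))) ^ 4 = δ * (s + 1 : ℕ) := by
      rw [show 4 = 2 * 2 from rfl, pow_mul, Real.sq_sqrt (by positivity),
        Real.sq_sqrt (by positivity)]
    have hδs : (δ * (s + 1 : ℕ)) = δ * s + δ := by push_cast; ring
    set a := Real.sqrt (Real.sqrt (δ * s))
    set b := Real.sqrt (Real.sqrt (δ * (s + 1 : ℕ)))
    set e := Real.sqrt δ with he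
    have he2 : e ^ 2 = δ := Real.sq_sqrt hδ.le
    -- Here `b⁴ = δ (s+1)` and `a⁴ = δ s`, so the increment `b - a` is at least `δ / (4 b³)`, while
    -- `ln y ≤ y - 1` at `y = 1 / b²` will bound the radius by `2 √δ / b³`.
    have hgap : e ^ 2 ≤ 4 * b ^ 3 * (b - a) := by
      have h5 : b ^ 4 - a ^ 4 = e ^ 2 := by rw [hb4, ha4, hδs, he2]; ring
      have h6 : b ^ 4 - a ^ 4 ≤ 4 * b ^ 3 * (b - a) := by
        have : 4 * b ^ 3 * (b - a) - (b ^ 4 - a ^ 4)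
          = (b - a) ^ 2 * (2 * b ^ 2 + (a + b) ^ 2) := by ring
        nlinarith [mul_nonneg (sq_nonneg (b - a)) (by positivity : 0 ≤ 2 * b ^ 2 + (a + b) ^ 2)]
      linarith
    have hb1' : 0 < b := hb
    have hlog : Real.log (max 1 (1 / (δ * (s + 1 : ℕ)))) ≤ 4 * (1 / b ^ 2) := by
      rw [max_eq_right (by rw [le_div_iff₀ (by positivity)]; linarith), ← hb4]
      have : (1 : ℝ) / b ^ 4 = (1 / b ^ 2) ^ 2 := by field_simp
      rw [this, Real.log_pow]
      have := Real.log_le_sub_one_of_pos (by positivity : (0 : ℝ) < 1 / b ^ 2)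
      have : (0 : ℝ) < 1 / b ^ 2 := by positivity
      push_cast; linarith
    have hr : radius δ (s + 1) ≤ 2 * e / b ^ 3 := by
      rw [radius]
      refine Real.sqrt_le_iff.2 ⟨by positivity, ?_⟩
      have hs2 : (1 : ℝ) / (s + 1 : ℕ) = e ^ 2 / b ^ 4 := by
        rw [hb4, he2]; field_simp
      calc _ ≤ 1 / ((s + 1 : ℕ) : ℝ) * (4 * (1 / b ^ 2)) := by gcongr
        _ = _ := by rw [hs2]; field_simp; ring
    refine hr.trans ?_
    rw [div_le_iff₀ (by positivity)]
    have : 8 / e * (b - a) * b ^ 3 = 2 / e * (4 * b ^ 3 * (b - a)) := by ring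
    rw [this]
    calc 2 * e = 2 / e * e ^ 2 := by field_simp
      _ ≤ _ := by gcongr

theorem sum_radius_le {δ : ℝ} (hδ : 0 < δ) (T : ℕ) :
    ∑ s ∈ Finset.range T, radius δ (s + 1) ≤ 8 / Real.sqrt δ := by
  refine (Finset.sum_le_sum fun s _ => radius_succ_le hδ s).trans ?_
  rw [← Finset.mul_sum, Finset.sum_range_sub
    (fun s : ℕ => min 1 (Real.sqrt (Real.sqrt (δ * s))))]
  refine mul_le_of_le_one_right (by positivity) ?_
  simp

theorem exp_neg_log_le {δ : ℝ} (hδ : 0 < δ) {n : ℕ} (hn : 1 ≤ n) :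
    Real.exp (-(Real.log (max 1 (1 / (δ * (2 * n)))))) = min 1 (2 * (n * δ)) := by
  have hn0 : (0 : ℝ) < n := by exact_mod_cast hn
  rw [Real.exp_neg, Real.exp_log (by positivity)]
  rcases le_total 1 (1 / (δ * (2 * n))) with h | h
  · rw [max_eq_right h]
    rw [le_div_iff₀ (by positivity)] at h
    rw [min_eq_right (by linarith)]; field_simp
  · rw [max_eq_left h]
    rw [div_le_one (by positivity)] at h
    rw [min_eq_left (by linarith)]; simp

/-- The weights of the dyadic blocks, compared with a telescoping sum. -/
theorem block_weight_le {δ r : ℝ} (hδ : 0 < δ) (hr : r = Real.sqrt (Real.sqrt 2))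
    {v L : ℝ} {n : ℕ} (hn : 1 ≤ n) (hv : 0 < v) (hv4 : v ^ 4 = n * δ)
    (hL : Real.exp (-L) = min 1 (2 * (n * δ))) :
    1 / Real.sqrt n * Real.exp (-(3 / 4 * L)) ≤
      80 * Real.sqrt δ * (r * v / (1 + r * v) - v / (1 + v)) := by
  have hn0 : (0 : ℝ) < n := by exact_mod_cast hn
  have hr4 : r ^ 4 = 2 := by
    rw [hr, show 4 = 2 * 2 from rfl, pow_mul, Real.sq_sqrt (by positivity),
      Real.sq_sqrt (by positivity)]
  have hr0 : 0 ≤ r := hr ▸ Real.sqrt_nonneg _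
  have hr1 : 1.15 ≤ r := by
    by_contra hc
    push Not at hc
    have : r ^ 4 < 1.15 ^ 4 := pow_lt_pow_left₀ hc hr0 (by norm_num)
    norm_num at this; linarith
  have hr2 : r ≤ 1.2 := by
    by_contra hc
    push Not at hc
    have : 1.2 ^ 4 < r ^ 4 := pow_lt_pow_left₀ hc (by norm_num) (by norm_num)
    norm_num at this; linarith
  have hw0 := Real.exp_pos (-(L / 4))
  have hw4 : Real.exp (-(L / 4)) ^ 4 = min 1 (2 * v ^ 4) := by
    rw [hv4, ← hL, ← Real.exp_nat_mul]; congr 1; push_cast; ring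
  have hw3 : Real.exp (-(3 / 4 * L)) = Real.exp (-(L / 4)) ^ 3 := by
    rw [← Real.exp_nat_mul]; congr 1; push_cast; ring
  rw [hw3]
  set w := Real.exp (-(L / 4))
  have hw1 : w ≤ 1 := by
    by_contra hc
    push Not at hc
    have h1 : 1 < w ^ 4 := one_lt_pow₀ hc (by norm_num)
    have := min_le_left 1 (2 * v ^ 4)
    linarith
  have hwv : w ≤ r * v := by
    by_contra hc
    push Not at hc
    have h1 := pow_lt_pow_left₀ hc (by positivity) (n := 4) (by norm_num)
    have := min_le_right 1 (2 * v ^ 4)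
    rw [mul_pow, hr4] at h1; linarith
  have hsn : 1 / Real.sqrt n = Real.sqrt δ / v ^ 2 := by
    have : v ^ 2 = Real.sqrt n * Real.sqrt δ := by
      rw [← Real.sqrt_mul hn0.le, ← hv4, show v ^ 4 = (v ^ 2) ^ 2 by ring,
        Real.sqrt_sq (by positivity)]
    have hd : 0 < Real.sqrt δ := Real.sqrt_pos.2 hδ
    rw [this]; field_simp
  rw [hsn]
  have hd : r * v / (1 + r * v) - v / (1 + v) = (r - 1) * v / ((1 + r * v) * (1 + v)) := by
    field_simp; ring
  rw [hd]
  -- The left side is at most `1.2³ v` for `v ≤ 1` and `1 / v²` for `v ≥ 1`. The increment of `v /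
  -- (1 + v)` from `v` to `r v` dominates both up to a constant; `80` is chosen so that `80 (r - 1)
  -- ≥ 12`.
  have key : w ^ 3 / v ^ 2 ≤ 80 * ((r - 1) * v / ((1 + r * v) * (1 + v))) := by
    have h80 : 12 * v / ((1 + 1.2 * v) * (1 + v)) ≤
        80 * ((r - 1) * v / ((1 + r * v) * (1 + v))) := by
      rw [← mul_div_assoc]
      have h12 : 12 * v ≤ 80 * ((r - 1) * v) := by nlinarith
      have h0 : 0 ≤ 80 * ((r - 1) * v) := by linarith
      gcongr
    refine le_trans ?_ h80
    rcases le_total v 1 with h | h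
    · calc w ^ 3 / v ^ 2 ≤ (r * v) ^ 3 / v ^ 2 := by gcongr
        _ = r ^ 3 * v := by field_simp
        _ ≤ 1.2 ^ 3 * v := by gcongr
        _ ≤ _ := by
          rw [le_div_iff₀ (by positivity)]
          have : (1 + 1.2 * v) * (1 + v) ≤ 4.4 := by nlinarith
          nlinarith
    · calc w ^ 3 / v ^ 2 ≤ 1 ^ 3 / v ^ 2 := by gcongr
        _ ≤ _ := by
          rw [div_le_div_iff₀ (by positivity) (by positivity)]
          nlinarith [mul_nonneg (sub_nonneg.2 h) hv.le,
            mul_nonneg (sub_nonneg.2 h) (sq_nonneg v)]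
  calc Real.sqrt δ / v ^ 2 * w ^ 3 = Real.sqrt δ * (w ^ 3 / v ^ 2) := by ring
    _ ≤ Real.sqrt δ * (80 * ((r - 1) * v / ((1 + r * v) * (1 + v)))) := by gcongr
    _ = _ := by ring

/-! ### Peeling: the largest excess over the radius. -/

namespace IsCenteredSum

variable {Ω : Type*} [mΩ : MeasurableSpace Ω] {P : Measure Ω} {ℱ : Filtration ℕ mΩ} {T : ℕ}
  {N : ℕ → Ω → ℕ} {M : ℕ → Ω → ℝ}

theorem excess_le_exp_runningMax (h : IsCenteredSum P ℱ T N M) {δ : ℝ} (hδ : 0 < δ) {n : ℕ}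
    (hn : 1 ≤ n) {L : ℝ} (hL : L = Real.log (max 1 (1 / (δ * (2 * n))))) {t : ℕ} (ht : t ≤ T)
    (ω : Ω) (h1 : n ≤ N t ω) (h2 : N t ω ≤ 2 * n) :
    M t ω / N t ω - radius δ (N t ω) ≤ 2 * (1 / Real.sqrt n * Real.exp (-(3 / 4 * L))) *
      Real.exp (3 / 4 * runningMax (logExp N M ((2 + 2 * Real.sqrt L) / Real.sqrt n)) T ω) := by
  have hn0 : (0 : ℝ) < n := by exact_mod_cast hn
  have h1' : (n : ℝ) ≤ N t ω := by exact_mod_cast h1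
  have h2' : (N t ω : ℝ) ≤ 2 * n := by exact_mod_cast h2
  have hL0 : 0 ≤ L := hL ▸ Real.log_nonneg (le_max_left _ _)
  have hK0 : (0 : ℝ) < N t ω := by linarith
  have hrad := sqrt_le_mul_radius hδ hn h1 h2
  rw [← hL, Real.sqrt_mul hn0.le] at hrad
  have hq : 0 < Real.sqrt n := Real.sqrt_pos.2 hn0
  have hqq : Real.sqrt n ^ 2 = n := Real.sq_sqrt hn0.le
  have hll : Real.sqrt L ^ 2 = L := Real.sq_sqrt hL0
  have hl0 : 0 ≤ Real.sqrt L := Real.sqrt_nonneg L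
  set q := Real.sqrt n
  set p := Real.sqrt L
  set l := (2 + 2 * p) / q with hl
  have hlpos : 0 < l := by positivity
  set G := runningMax (logExp N M l) T ω with hG
  have hGle : logExp N M l t ω ≤ G := le_runningMax (h.logExp_zero l) T t ht ω
  set z := M t ω / N t ω - radius δ (N t ω) with hz
  have hMz : M t ω = N t ω * z + N t ω * radius δ (N t ω) := by rw [hz]; field_simp; ring
  rcases le_total z 0 with hz0 | hz0
  · exact hz0.trans (by positivity)
  have hlq : l * q = 2 + 2 * p := by rw [hl]; field_simp
  -- For `l = (2 + 2√L) / √n` the radius contributes at least `2√L + 2L` and the compensator at most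
  -- `(1 + √L)²`; their difference leaves the gain `L - 1`.
  have hmain : l * n * z ≤ G + (1 - L) := by
    have e1 : l * (N t ω * z) ≥ l * (n * z) := by gcongr
    have e2 : l * (N t ω * radius δ (N t ω)) ≥ l * (q * p) := by gcongr
    have e3 : l ^ 2 / 8 * N t ω ≤ l ^ 2 / 8 * (2 * n) := by gcongr
    have e4 : l ^ 2 / 8 * (2 * n) = (1 + p) ^ 2 := by
      rw [← hqq]
      calc _ = (l * q) ^ 2 / 4 := by ring
        _ = _ := by rw [hlq]; ring
    have e5 : l * (q * p) = 2 * p + 2 * p ^ 2 := by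
      rw [← mul_assoc, hlq]; ring
    have e6 : logExp N M l t ω = l * (N t ω * z) + l * (N t ω * radius δ (N t ω))
      - l ^ 2 / 8 * N t ω := by rw [logExp, hMz]; ring
    nlinarith
  have ha : 0 < 3 / 4 * (l * n) := by positivity
  refine (le_max_left z 0).trans ((pos_part_le_exp ha z).trans ?_)
  have hexp : Real.exp (3 / 4 * (l * n) * z) ≤
      Real.exp (3 / 4) * (Real.exp (-(3 / 4 * L)) * Real.exp (3 / 4 * G)) := by
    rw [← Real.exp_add, ← Real.exp_add]
    exact Real.exp_le_exp.2 (by nlinarith)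
  have he : Real.exp (3 / 4) ≤ 3 :=
    (Real.exp_le_exp.2 (by norm_num)).trans (Real.exp_one_lt_d9.le.trans (by norm_num))
  have hln : 3 / 2 * q ≤ 3 / 4 * (l * n) := by
    rw [← hqq]
    have : l * q ^ 2 = (2 + 2 * p) * q := by rw [← hlq]; ring
    rw [this]; nlinarith [mul_nonneg hl0 hq.le]
  have hB : 0 < Real.exp (-(3 / 4 * L)) * Real.exp (3 / 4 * G) := by positivity
  calc _ ≤ 3 * (Real.exp (-(3 / 4 * L)) * Real.exp (3 / 4 * G)) / (3 / 2 * q) := by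
        gcongr
        exact hexp.trans (by gcongr)
    _ = _ := by field_simp

/-- The maximal excess of the deviations over the radius. -/
theorem exists_excess_le [IsProbabilityMeasure P] (h : IsCenteredSum P ℱ T N M) {δ : ℝ}
    (hδ : 0 < δ) : ∃ Z : Ω → ENNReal,
      (∀ t ≤ T, ∀ ω, 1 ≤ N t ω → ENNReal.ofReal (M t ω / N t ω - radius δ (N t ω)) ≤ Z ω) ∧
      ∫⁻ ω, Z ω ∂P ≤ ENNReal.ofReal (640 * Real.sqrt δ) := by
  set L : ℕ → ℝ := fun j => Real.log (max 1 (1 / (δ * (2 * (2 ^ j : ℕ))))) with hL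
  set K : ℕ → ℝ := fun j => 2 * (1 / Real.sqrt (2 ^ j : ℕ) * Real.exp (-(3 / 4 * L j))) with hK
  set F : ℕ → Ω → ℝ := fun j ω => Real.exp (3 / 4 * runningMax
    (logExp N M ((2 + 2 * Real.sqrt (L j)) / Real.sqrt (2 ^ j : ℕ))) T ω) with hF
  -- Block `j` covers counts between `2^j` and `2^(j+1)`; since counts are at most `T`, the blocks
  -- `j ≤ T` suffice.
  refine ⟨fun ω => ∑ j ∈ Finset.range (T + 1), ENNReal.ofReal (K j) * ENNReal.ofReal (F j ω),
    fun t ht ω hN => ?_, ?_⟩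
  · have hj : Nat.log 2 (N t ω) < T + 1 :=
      lt_of_le_of_lt (Nat.log_le_self 2 _) (by have := h.count_le t ht ω; omega)
    refine le_trans ?_ (Finset.single_le_sum
      (f := fun j => ENNReal.ofReal (K j) * ENNReal.ofReal (F j ω)) (fun _ _ => zero_le)
      (Finset.mem_range.2 hj))
    rw [← ENNReal.ofReal_mul (by positivity)]
    refine ENNReal.ofReal_le_ofReal (h.excess_le_exp_runningMax hδ Nat.one_le_two_pow rfl ht ω
      (Nat.pow_log_le_self 2 (by omega)) ?_)
    have := Nat.lt_pow_succ_log_self (b := 2) (by norm_num) (N t ω)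
    rw [pow_succ] at this; omega
  · have hFm : ∀ j, Measurable fun ω => ENNReal.ofReal (F j ω) := fun j =>
      (Real.measurable_exp.comp (((h.measurable_runningMax _ T le_rfl).mono (ℱ.le T)
        le_rfl).const_mul _)).ennreal_ofReal
    set r := Real.sqrt (Real.sqrt 2) with hr
    set v₀ := Real.sqrt (Real.sqrt δ) with hv₀
    have hv₀p : 0 < v₀ := by positivity
    have hr4 : r ^ 4 = 2 := by
      rw [hr, show 4 = 2 * 2 from rfl, pow_mul, Real.sq_sqrt (by positivity),
        Real.sq_sqrt (by positivity)]
    have hv4 : v₀ ^ 4 = δ := by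
      rw [hv₀, show 4 = 2 * 2 from rfl, pow_mul, Real.sq_sqrt (by positivity),
        Real.sq_sqrt (by positivity)]
    have hrp : 0 < r := by positivity
    -- `H` takes values in `[0, 1]`, so the block weights sum to at most `160 √δ`; the maximal
    -- inequality multiplies this by `4`.
    set H : ℕ → ℝ := fun j => r ^ j * v₀ / (1 + r ^ j * v₀) with hH
    have hKH : ∀ j, K j ≤ 160 * Real.sqrt δ * (H (j + 1) - H j) := fun j => by
      have := block_weight_le hδ hr (v := r ^ j * v₀) (L := L j) (n := 2 ^ j) Nat.one_le_two_pow
        (by positivity) (by rw [mul_pow, ← pow_mul, mul_comm j 4, pow_mul, hr4, hv4]; push_cast; rfl)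
        (exp_neg_log_le hδ Nat.one_le_two_pow)
      simp only [hK, hH]
      have e : r ^ (j + 1) * v₀ = r * (r ^ j * v₀) := by ring
      rw [e]; linarith
    calc _ = ∑ j ∈ Finset.range (T + 1), ∫⁻ ω, ENNReal.ofReal (K j) * ENNReal.ofReal (F j ω) ∂P :=
          lintegral_finsetSum _ fun j _ => (hFm j).const_mul _
      _ ≤ ∑ j ∈ Finset.range (T + 1), ENNReal.ofReal (K j) * 4 := by
          refine Finset.sum_le_sum fun j _ => ?_
          rw [lintegral_const_mul _ (hFm j)]
          gcongr
          exact h.lintegral_exp_runningMax_le _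
      _ = ENNReal.ofReal ((∑ j ∈ Finset.range (T + 1), K j) * 4) := by
          rw [← Finset.sum_mul, ENNReal.ofReal_mul (Finset.sum_nonneg fun j _ => by positivity),
            ENNReal.ofReal_sum_of_nonneg fun j _ => by positivity]
          simp
      _ ≤ _ := by
          refine ENNReal.ofReal_le_ofReal ?_
          have h1 := Finset.sum_le_sum (s := Finset.range (T + 1)) fun j _ => hKH j
          rw [← Finset.mul_sum (f := fun j => H (j + 1) - H j), Finset.sum_range_sub] at h1
          have h2 : H (T + 1) ≤ 1 := by
            simp only [hH]; rw [div_le_one (by positivity)]; linarith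
          have h3 : 0 ≤ H 0 := by positivity
          have h4 : 0 < Real.sqrt δ := Real.sqrt_pos.2 hδ
          nlinarith

end IsCenteredSum

/-! ### One round of cascading feedback. -/

section Outcome

variable {m : ℕ} (form : Form) (D : Fin m → Measure ℝ)

theorem measurableSet_mem_triggered (σ : Equiv.Perm (Fin m)) (B : Finset (Fin m)) (i : Fin m) :
    MeasurableSet {x : Fin m → ℝ | i ∈ triggered form σ B x} := by
  have : {x : Fin m → ℝ | i ∈ triggered form σ B x} =
      {_x | i ∈ B} ∩ ⋂ j ∈ {j | j ∈ B ∧ σ j < σ i}, {x | x j ≠ form.stopOutcome} := by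
    ext x; simp [triggered]
  rw [this]
  refine (MeasurableSet.const _).inter (MeasurableSet.biInter (Set.to_countable _) fun j _ => ?_)
  exact measurableSet_eq_fun (measurable_pi_apply j) measurable_const |>.compl

/-- Revelation of an arm depends only on the arms placed strictly before it. Hence observing it
selectively does not bias its outcome. -/
theorem mem_triggered_update (σ : Equiv.Perm (Fin m)) (B : Finset (Fin m)) (i : Fin m)
    (x : Fin m → ℝ) (y : ℝ) :
    i ∈ triggered form σ B (Function.update x i y) ↔ i ∈ triggered form σ B x := by
  simp only [triggered, Finset.mem_filter]
  refine and_congr_right fun _ => forall_congr' fun j => forall_congr' fun _ =>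
    forall_congr' fun hj => ?_
  rw [Function.update_of_ne (by rintro rfl; exact lt_irrefl _ hj)]

theorem triggered_subset (σ : Equiv.Perm (Fin m)) (B : Finset (Fin m)) (x : Fin m → ℝ) :
    triggered form σ B x ⊆ B := Finset.filter_subset _ _

/-- Hoeffding's lemma for the outcome of an arm. -/
theorem lintegral_exp_centered_le {ν : Measure ℝ} [IsProbabilityMeasure ν]
    (hν : ∀ᵐ y ∂ν, y ∈ Set.Icc (0 : ℝ) 1) (l : ℝ) :
    ∫⁻ y, ENNReal.ofReal (Real.exp (l * (y - ∫ z, z ∂ν) - l ^ 2 / 8)) ∂ν ≤ 1 := by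
  have hs := hasSubgaussianMGF_of_mem_Icc (X := fun y : ℝ => y) (μ := ν) aemeasurable_id hν
  have h1 := hs.mgf_le l
  have hi := hs.integrable_exp_mul l
  have e : ∀ y : ℝ, Real.exp (l * (y - ∫ z, z ∂ν) - l ^ 2 / 8)
      = Real.exp (-(l ^ 2 / 8)) * Real.exp (l * (y - ∫ z, z ∂ν)) := fun y => by
    rw [← Real.exp_add]; congr 1; ring
  simp_rw [e]
  rw [← ofReal_integral_eq_lintegral_ofReal (hi.const_mul _)
    (Filter.Eventually.of_forall fun y => by positivity), integral_const_mul,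
    ENNReal.ofReal_le_one]
  rw [mgf] at h1
  refine (mul_le_mul_of_nonneg_left h1 (Real.exp_pos _).le).trans ?_
  rw [← Real.exp_add, Real.exp_le_one_iff]
  simp only [sub_zero, nnnorm_one]
  push_cast
  linarith

theorem pStar_le {σ : ℕ → Finset (Fin m) → Equiv.Perm (Fin m)}
    {𝒜 : Finset (Finset (Fin m))} {T t : ℕ} (ht : t < T) {B : Finset (Fin m)} (hB : B ∈ 𝒜) :
    pStar form D σ 𝒜 T ≤ fullObservationProb form D σ B t :=
  ciInf_le (f := fun q : Fin T × {A : Finset (Fin m) // A ∈ 𝒜} =>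
    fullObservationProb form D σ q.2.1 q.1) (Set.finite_range _).bddBelow (⟨t, ht⟩, ⟨B, hB⟩)

variable [∀ i, IsProbabilityMeasure (D i)]

open Classical in
-- Integrate over coordinate `i` first: the revelation event is then constant, and Hoeffding's lemma
-- applies on it.
theorem lintegral_exp_triggered_le (hD : ∀ i, ∀ᵐ y ∂(D i), y ∈ Set.Icc (0 : ℝ) 1)
    (σ : Equiv.Perm (Fin m)) (B : Finset (Fin m)) (i : Fin m) (l : ℝ) :
    ∫⁻ x, ENNReal.ofReal (Real.exp (if i ∈ triggered form σ B x then
      l * (x i - means D i) - l ^ 2 / 8 else 0)) ∂(Measure.pi D) ≤ 1 := by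
  have hm : Measurable fun x : Fin m → ℝ => ENNReal.ofReal (Real.exp (
      if i ∈ triggered form σ B x then l * (x i - means D i) - l ^ 2 / 8 else 0)) := by
    refine (Real.measurable_exp.comp (Measurable.ite
      (measurableSet_mem_triggered form σ B i) ?_ measurable_const)).ennreal_ofReal
    exact (((measurable_pi_apply i).sub_const _).const_mul _).sub_const _
  refine (lintegral_le_of_lmarginal_le (g := fun _ => 1) {i} hm measurable_const ?_).trans
    (by simp)
  rw [lmarginal_singleton, lmarginal_singleton]
  intro x
  simp only [mem_triggered_update, Function.update_self, lintegral_const, measure_univ, mul_one]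
  split_ifs
  · exact lintegral_exp_centered_le (hD i) l
  · simp

theorem fullObservationProb_le {σ : ℕ → Finset (Fin m) → Equiv.Perm (Fin m)}
    {B : Finset (Fin m)} {i : Fin m} (hi : i ∈ B) (t : ℕ) :
    ENNReal.ofReal (fullObservationProb form D σ B t) ≤
      (Measure.pi D) {x | i ∈ triggered form (σ t B) B x} := by
  rw [fullObservationProb, ofReal_measureReal]
  refine measure_mono fun x hx => ?_
  change i ∈ triggered form (σ t B) B x
  rw [show triggered form (σ t B) B x = B from hx]; exact hi

theorem means_mem (hD : ∀ i, ∀ᵐ y ∂(D i), y ∈ Set.Icc (0 : ℝ) 1) (i : Fin m) :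
    means D i ∈ Set.Icc (0 : ℝ) 1 := by
  have hint : Integrable (fun y : ℝ => y) (D i) :=
    Integrable.of_mem_Icc 0 1 aemeasurable_id (hD i)
  refine ⟨integral_nonneg_of_ae ((hD i).mono fun y hy => hy.1), ?_⟩
  calc means D i ≤ ∫ _, (1 : ℝ) ∂(D i) :=
        integral_mono_ae hint (integrable_const _) ((hD i).mono fun y hy => hy.2)
    _ = 1 := by simp

end Outcome

/-! ### Lipschitz continuity of the reward. -/

section Reward

variable {ι : Type*}

theorem prod_sub_prod_le (s : Finset ι) (u v : ι → ℝ) (hu : ∀ i ∈ s, u i ∈ Set.Icc (0 : ℝ) 1)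
    (hv : ∀ i ∈ s, v i ∈ Set.Icc (0 : ℝ) 1) :
    ∏ i ∈ s, u i - ∏ i ∈ s, v i ≤ ∑ i ∈ s, max (u i - v i) 0 := by
  classical
  induction s using Finset.induction_on with
  | empty => simp
  | insert a s ha ih =>
    rw [Finset.prod_insert ha, Finset.prod_insert ha, Finset.sum_insert ha]
    have ih' := ih (fun i hi => hu i (Finset.mem_insert_of_mem hi))
      (fun i hi => hv i (Finset.mem_insert_of_mem hi))
    have hS : 0 ≤ ∑ i ∈ s, max (u i - v i) 0 := Finset.sum_nonneg fun i _ => le_max_right _ _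
    have hU0 : 0 ≤ ∏ i ∈ s, u i :=
      Finset.prod_nonneg fun i hi => (hu i (Finset.mem_insert_of_mem hi)).1
    have hU1 : ∏ i ∈ s, u i ≤ 1 :=
      Finset.prod_le_one (fun i hi => (hu i (Finset.mem_insert_of_mem hi)).1)
        fun i hi => (hu i (Finset.mem_insert_of_mem hi)).2
    obtain ⟨hv0, hv1⟩ := hv a (Finset.mem_insert_self a s)
    have h1 : (u a - v a) * ∏ i ∈ s, u i ≤ max (u a - v a) 0 :=
      (mul_le_mul_of_nonneg_right (le_max_left _ 0) hU0).trans
        (mul_le_of_le_one_right (le_max_right _ _) hU1)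
    have h2 : v a * (∏ i ∈ s, u i - ∏ i ∈ s, v i) ≤ ∑ i ∈ s, max (u i - v i) 0 :=
      (mul_le_mul_of_nonneg_left ih' hv0).trans (mul_le_of_le_one_left hS hv1)
    linarith

/-- The reward is monotone and `1`-Lipschitz for the `ℓ¹` distance of the mean vectors. -/
theorem reward_sub_reward_le {m : ℕ} (form : Form) (B : Finset (Fin m)) (u v : Fin m → ℝ)
    (hu : ∀ i, u i ∈ Set.Icc (0 : ℝ) 1) (hv : ∀ i, v i ∈ Set.Icc (0 : ℝ) 1) :
    reward form B u - reward form B v ≤ ∑ i ∈ B, max (u i - v i) 0 := by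
  cases form with
  | disjunctive =>
    have := prod_sub_prod_le B (fun i => 1 - v i) (fun i => 1 - u i)
      (fun i _ => ⟨by linarith [(hv i).2], by linarith [(hv i).1]⟩)
      (fun i _ => ⟨by linarith [(hu i).2], by linarith [(hu i).1]⟩)
    simp only [sub_sub_sub_cancel_left] at this
    simp only [reward]; linarith
  | conjunctive => exact prod_sub_prod_le B u v (fun i _ => hu i) (fun i _ => hv i)

end Reward

/-! ### The memory along a trajectory. -/

section Run

variable {m : ℕ} {form : Form} {D : Fin m → Measure ℝ}
  {σ : ℕ → Finset (Fin m) → Equiv.Perm (Fin m)} {Ω : Type*}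

/-- The memory along a trajectory. -/
noncomputable def runStats (form : Form) (σ : ℕ → Finset (Fin m) → Equiv.Perm (Fin m))
    (X : ℕ → Ω → Fin m → ℝ) (A : ℕ → Ω → Finset (Fin m)) (t : ℕ) (ω : Ω) : ArmStats m :=
  stats form σ (fun s => A s ω) (fun s => X s ω) t

open Classical in
/-- The sum of the centered observed outcomes of an arm. -/
noncomputable def centeredSum (form : Form) (D : Fin m → Measure ℝ)
    (σ : ℕ → Finset (Fin m) → Equiv.Perm (Fin m))
    (X : ℕ → Ω → Fin m → ℝ) (A : ℕ → Ω → Finset (Fin m)) (i : Fin m) (t : ℕ) (ω : Ω) : ℝ :=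
  ∑ s ∈ Finset.range t, if i ∈ triggered form (σ s (A s ω)) (A s ω) (X s ω) then
    X s ω i - means D i else 0

variable {X : ℕ → Ω → Fin m → ℝ} {A : ℕ → Ω → Finset (Fin m)}

open Classical in
theorem centeredSum_succ (i : Fin m) (t : ℕ) (ω : Ω) :
    centeredSum form D σ X A i (t + 1) ω = centeredSum form D σ X A i t ω +
      if i ∈ triggered form (σ t (A t ω)) (A t ω) (X t ω) then X t ω i - means D i else 0 :=
  Finset.sum_range_succ _ _

open Classical in
theorem runStats_count_succ (i : Fin m) (t : ℕ) (ω : Ω) :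
    (runStats form σ X A (t + 1) ω).count i = (runStats form σ X A t ω).count i +
      if i ∈ triggered form (σ t (A t ω)) (A t ω) (X t ω) then 1 else 0 := by
  simp only [runStats, stats, ArmStats.update]
  split_ifs <;> rfl

open Classical in
theorem runStats_mean_succ (i : Fin m) (t : ℕ) (ω : Ω) :
    (runStats form σ X A (t + 1) ω).mean i =
      if i ∈ triggered form (σ t (A t ω)) (A t ω) (X t ω) then
        (runStats form σ X A t ω).mean i + (X t ω i - (runStats form σ X A t ω).mean i) /
          (((runStats form σ X A t ω).count i : ℝ) + 1)
      else (runStats form σ X A t ω).mean i := by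
  simp only [runStats, stats, ArmStats.update]
  push_cast
  congr

/-- Multiplying by the count erases the arbitrary initial mean `1`, so the identity also holds
before the first observation. -/
theorem count_mul_mean (i : Fin m) (t : ℕ) (ω : Ω) :
    ((runStats form σ X A t ω).count i : ℝ) * (runStats form σ X A t ω).mean i =
      centeredSum form D σ X A i t ω + (runStats form σ X A t ω).count i * means D i := by
  induction t with
  | zero => simp [runStats, stats, centeredSum]
  | succ t ih =>
    rw [centeredSum_succ, runStats_count_succ, runStats_mean_succ]
    split_ifs
    · have : ((runStats form σ X A t ω).count i : ℝ) + 1 ≠ 0 := by positivity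
      push_cast
      rw [mul_add, mul_div_cancel₀ _ this]
      linarith
    · simpa using ih

theorem mean_eq (i : Fin m) (t : ℕ) (ω : Ω) (h : 1 ≤ (runStats form σ X A t ω).count i) :
    (runStats form σ X A t ω).mean i = means D i +
      centeredSum form D σ X A i t ω / (runStats form σ X A t ω).count i := by
  have h0 : (0 : ℝ) < (runStats form σ X A t ω).count i := by exact_mod_cast h
  have := count_mul_mean (form := form) (D := D) (σ := σ) (X := X) (A := A) i t ω
  field_simp
  linarith

theorem mean_mem (ω : Ω) {T : ℕ} (hX : ∀ t < T, ∀ i, X t ω i ∈ Set.Icc (0 : ℝ) 1) (t : ℕ)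
    (ht : t ≤ T) (i : Fin m) : (runStats form σ X A t ω).mean i ∈ Set.Icc (0 : ℝ) 1 := by
  induction t with
  | zero => simp [runStats, stats]
  | succ t ih =>
    rw [runStats_mean_succ]
    split_ifs
    · obtain ⟨a0, a1⟩ := ih (by omega)
      obtain ⟨b0, b1⟩ := hX t (by omega) i
      have hc : (0 : ℝ) ≤ (runStats form σ X A t ω).count i := Nat.cast_nonneg _
      set c : ℝ := ((runStats form σ X A t ω).count i : ℝ)
      set a := (runStats form σ X A t ω).mean i
      have e : a + (X t ω i - a) / (c + 1) = (a * c + X t ω i) / (c + 1) := by field_simp; ring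
      rw [e]
      refine ⟨by positivity, ?_⟩
      rw [div_le_one (by positivity)]; nlinarith
    · exact ih (by omega)

theorem ucb_mem (δ : ℝ) (S : ArmStats m) (i : Fin m) (h : 0 ≤ S.mean i) :
    ucb δ S i ∈ Set.Icc (0 : ℝ) 1 := by
  rw [ucb]
  split_ifs
  · simp
  · exact ⟨le_min (add_nonneg h (Real.sqrt_nonneg _)) zero_le_one, min_le_right _ _⟩

end Run

/-! ### Measurability and conditioning on the past. -/

namespace IsCMOSSRun

variable {m : ℕ} {Ω : Type*} [mΩ : MeasurableSpace Ω] {P : Measure Ω} {form : Form}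
  {D : Fin m → Measure ℝ} {σ : ℕ → Finset (Fin m) → Equiv.Perm (Fin m)}
  {𝒜 : Finset (Finset (Fin m))} {δ : ℝ} {T : ℕ} {ℱ : Filtration ℕ mΩ}
  {X : ℕ → Ω → Fin m → ℝ} {A : ℕ → Ω → Finset (Fin m)}

theorem measurableSet_triggered (h : IsCMOSSRun P form D σ 𝒜 δ T ℱ X A) (i : Fin m) (t : ℕ)
    (ht : t < T) :
    MeasurableSet[ℱ (t + 1)] {ω | i ∈ triggered form (σ t (A t ω)) (A t ω) (X t ω)} := by
  have : {ω | i ∈ triggered form (σ t (A t ω)) (A t ω) (X t ω)} =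
      ⋃ B : Finset (Fin m), {ω | A t ω = B} ∩ X t ⁻¹' {x | i ∈ triggered form (σ t B) B x} := by
    ext ω; simp
  rw [this]
  refine MeasurableSet.iUnion fun B => MeasurableSet.inter ?_ ?_
  · exact ℱ.mono (Nat.le_succ t) _ (h.measurable_action t ht B)
  · exact h.measurable_outcome t ht (measurableSet_mem_triggered form (σ t B) B i)

theorem measurable_count (h : IsCMOSSRun P form D σ 𝒜 δ T ℱ X A) (i : Fin m) (t : ℕ)
    (ht : t ≤ T) : Measurable[ℱ t] fun ω => (runStats form σ X A t ω).count i := by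
  classical
  induction t with
  | zero => exact measurable_const
  | succ t ih =>
    simp_rw [runStats_count_succ]
    refine ((ih (by omega)).mono (ℱ.mono (Nat.le_succ t)) le_rfl).add ?_
    exact Measurable.ite (h.measurableSet_triggered i t ht) measurable_const measurable_const

theorem measurable_outcome_apply (h : IsCMOSSRun P form D σ 𝒜 δ T ℱ X A) (i : Fin m) (t : ℕ)
    (ht : t < T) : Measurable[ℱ (t + 1)] fun ω => X t ω i :=
  (measurable_pi_apply i).comp (h.measurable_outcome t ht)

theorem measurable_centeredSum (h : IsCMOSSRun P form D σ 𝒜 δ T ℱ X A) (i : Fin m) (t : ℕ)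
    (ht : t ≤ T) : Measurable[ℱ t] (centeredSum form D σ X A i t) := by
  classical
  refine Finset.measurable_sum _ fun s hs => ?_
  have hs' := Finset.mem_range.1 hs
  refine Measurable.mono (Measurable.ite (h.measurableSet_triggered i s (by omega))
    ((h.measurable_outcome_apply i s (by omega)).sub_const _) measurable_const)
    (ℱ.mono hs') le_rfl

theorem measurable_mean (h : IsCMOSSRun P form D σ 𝒜 δ T ℱ X A) (i : Fin m) (t : ℕ)
    (ht : t ≤ T) : Measurable[ℱ t] fun ω => (runStats form σ X A t ω).mean i := by
  classical
  induction t with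
  | zero => exact measurable_const
  | succ t ih =>
    simp_rw [runStats_mean_succ]
    have h1 := (ih (by omega)).mono (ℱ.mono (Nat.le_succ t)) le_rfl
    have h2 : Measurable[ℱ (t + 1)] fun ω => ((runStats form σ X A t ω).count i : ℝ) :=
      ((measurable_from_top (f := fun n : ℕ => (n : ℝ))).comp
        (h.measurable_count i t (by omega))).mono (ℱ.mono (Nat.le_succ t)) le_rfl
    exact Measurable.ite (h.measurableSet_triggered i t ht)
      (h1.add (((h.measurable_outcome_apply i t ht).sub h1).div (h2.add_const 1))) h1

theorem measurable_ucb (h : IsCMOSSRun P form D σ 𝒜 δ T ℱ X A) (i : Fin m) (t : ℕ)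
    (ht : t ≤ T) : Measurable[ℱ t] fun ω => ucb δ (runStats form σ X A t ω) i := by
  simp only [ucb]
  refine Measurable.ite (h.measurable_count i t ht (measurableSet_singleton 0)) measurable_const ?_
  exact ((h.measurable_mean i t ht).add ((measurable_from_top (f := radius δ)).comp
    (h.measurable_count i t ht))).min measurable_const

/-- Integration over the outcomes of a round, given the past. -/
theorem lintegral_mul_action_outcome (h : IsCMOSSRun P form D σ 𝒜 δ T ℱ X A) {t : ℕ}
    (ht : t < T) {g : Ω → ENNReal} (hg : Measurable[ℱ t] g)
    {φ : Finset (Fin m) → (Fin m → ℝ) → ENNReal} (hφ : ∀ B, Measurable (φ B)) :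
    ∫⁻ ω, g ω * φ (A t ω) (X t ω) ∂P = ∫⁻ ω, g ω * ∫⁻ x, φ (A t ω) x ∂(Measure.pi D) ∂P := by
  classical
  have hXt : Measurable (X t) := (h.measurable_outcome t ht).mono (ℱ.le _) le_rfl
  have hgB : ∀ B : Finset (Fin m), Measurable[ℱ t] fun ω => if B = A t ω then g ω else 0 :=
    fun B => Measurable.ite (by simpa only [eq_comm] using h.measurable_action t ht B) hg
      measurable_const
  -- The action takes finitely many values; once it is fixed, each summand is a product of a past
  -- factor and an independent outcome factor.
  have e1 : ∀ ω, g ω * φ (A t ω) (X t ω) =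
      ∑ B : Finset (Fin m), (if B = A t ω then g ω else 0) * φ B (X t ω) := fun ω => by
    simp [ite_mul]
  have e2 : ∀ ω, g ω * ∫⁻ x, φ (A t ω) x ∂(Measure.pi D) =
      ∑ B : Finset (Fin m), (if B = A t ω then g ω else 0) * ∫⁻ x, φ B x ∂(Measure.pi D) :=
    fun ω => by simp [ite_mul]
  simp_rw [e1, e2]
  have hgB' := fun B => (hgB B).mono (ℱ.le t) le_rfl
  have hgφ : ∀ B, Measurable fun ω => (if B = A t ω then g ω else 0) * φ B (X t ω) :=
    fun B => (hgB' B).mul ((hφ B).comp hXt)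
  rw [lintegral_finsetSum _ fun B _ => hgφ B,
    lintegral_finsetSum _ fun B _ => (hgB' B).mul_const _]
  refine Finset.sum_congr rfl fun B _ => ?_
  rw [lintegral_mul_const _ (hgB' B), ← h.law_outcome t ht,
    lintegral_map (hφ B) hXt]
  exact lintegral_mul_eq_lintegral_mul_lintegral_of_independent_measurableSpace (ℱ.le t)
    hXt.comap_le (h.indep_past t ht).symm (hgB B) ((hφ B).comp (comap_measurable (X t)))

theorem sum_count_le (h : IsCMOSSRun P form D σ 𝒜 δ T ℱ X A) {k : ℕ} (hk : ∀ B ∈ 𝒜, B.card ≤ k)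
    (ω : Ω) (t : ℕ) (ht : t ≤ T) : ∑ i, (runStats form σ X A t ω).count i ≤ k * t := by
  classical
  induction t with
  | zero => simp [runStats, stats]
  | succ t ih =>
    simp_rw [runStats_count_succ]
    rw [Finset.sum_add_distrib, Finset.sum_boole]
    have h1 : (Finset.univ.filter fun i =>
        i ∈ triggered form (σ t (A t ω)) (A t ω) (X t ω)).card ≤ k := by
      refine (Finset.card_le_card ?_).trans (hk _ (h.action_mem t ht ω))
      intro i hi
      exact triggered_subset _ _ _ _ (Finset.mem_filter.1 hi).2
    have := ih (by omega)
    simp only [Nat.cast_id]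
    rw [mul_add]; omega

variable [∀ i, IsProbabilityMeasure (D i)]

theorem isCenteredSum (h : IsCMOSSRun P form D σ 𝒜 δ T ℱ X A)
    (hD : ∀ i, ∀ᵐ y ∂(D i), y ∈ Set.Icc (0 : ℝ) 1) (i : Fin m) :
    IsCenteredSum P ℱ T (fun t ω => (runStats form σ X A t ω).count i)
      (centeredSum form D σ X A i) where
  count_zero _ := rfl
  sum_zero _ := by simp [centeredSum]
  measurable_count := h.measurable_count i
  measurable_sum := h.measurable_centeredSum i
  step t _ ω := by
    rw [runStats_count_succ, centeredSum_succ]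
    split_ifs <;> simp
  exp_step l t ht g hg := by
    classical
    set φ : Finset (Fin m) → (Fin m → ℝ) → ENNReal := fun B x => ENNReal.ofReal (Real.exp (
      if i ∈ triggered form (σ t B) B x then l * (x i - means D i) - l ^ 2 / 8 else 0)) with hφ
    have hφm : ∀ B, Measurable (φ B) := fun B =>
      (Real.measurable_exp.comp (Measurable.ite (measurableSet_mem_triggered form (σ t B) B i)
        ((((measurable_pi_apply i).sub_const _).const_mul _).sub_const _)
        measurable_const)).ennreal_ofReal
    have e : ∀ ω, g ω * ENNReal.ofReal (Real.exp (l * (centeredSum form D σ X A i (t + 1) ω -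
        centeredSum form D σ X A i t ω) - l ^ 2 / 8 *
        (((runStats form σ X A (t + 1) ω).count i : ℝ) - (runStats form σ X A t ω).count i))) =
        g ω * φ (A t ω) (X t ω) := fun ω => by
      rw [runStats_count_succ, centeredSum_succ]
      simp only [hφ]
      split_ifs with hi <;> simp
    rw [lintegral_congr e, h.lintegral_mul_action_outcome ht hg hφm]
    refine lintegral_mono fun ω => ?_
    calc _ ≤ g ω * 1 := by gcongr; exact lintegral_exp_triggered_le form D hD _ _ i l
      _ = g ω := mul_one _

open Classical in
/-- An arm of the action is observed with probability at least `p*`, given the past. -/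
theorem pStar_mul_lintegral_le (h : IsCMOSSRun P form D σ 𝒜 δ T ℱ X A) {t : ℕ}
    (ht : t < T) {g : Ω → ENNReal} (hg : Measurable[ℱ t] g) (i : Fin m) :
    ENNReal.ofReal (pStar form D σ 𝒜 T) * ∫⁻ ω, (if i ∈ A t ω then g ω else 0) ∂P ≤
      ∫⁻ ω, (if i ∈ triggered form (σ t (A t ω)) (A t ω) (X t ω) then g ω else 0) ∂P := by
  set φ : Finset (Fin m) → (Fin m → ℝ) → ENNReal := fun B =>
    {x | i ∈ triggered form (σ t B) B x}.indicator fun _ => 1 with hφ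
  have e : ∀ ω, (if i ∈ triggered form (σ t (A t ω)) (A t ω) (X t ω) then g ω else 0) =
      g ω * φ (A t ω) (X t ω) := fun ω => by simp [hφ, Set.indicator_apply]
  rw [lintegral_congr e, h.lintegral_mul_action_outcome ht hg fun B =>
    measurable_const.indicator (measurableSet_mem_triggered form (σ t B) B i),
    ← lintegral_const_mul' _ _ ENNReal.ofReal_ne_top]
  refine lintegral_mono fun ω => ?_
  rw [lintegral_indicator_const (measurableSet_mem_triggered form _ _ i), one_mul]
  split_ifs with hi
  · rw [mul_comm]
    gcongr
    exact (ENNReal.ofReal_le_ofReal (pStar_le form D ht (h.action_mem t ht ω))).trans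
      (fullObservationProb_le form D hi t)
  · simp

theorem ae_outcome_mem (h : IsCMOSSRun P form D σ 𝒜 δ T ℱ X A)
    (hD : ∀ i, ∀ᵐ y ∂(D i), y ∈ Set.Icc (0 : ℝ) 1) :
    ∀ᵐ ω ∂P, ∀ t < T, ∀ i, X t ω i ∈ Set.Icc (0 : ℝ) 1 := by
  rw [ae_all_iff]; intro t
  rw [ae_all_iff]; intro ht
  have hXt : Measurable (X t) := (h.measurable_outcome t ht).mono (ℱ.le _) le_rfl
  have h1 : ∀ᵐ x ∂(Measure.pi D), ∀ i, x i ∈ Set.Icc (0 : ℝ) 1 := by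
    rw [ae_all_iff]; intro i
    exact (measurePreserving_eval D i).quasiMeasurePreserving.ae (hD i)
  rw [← h.law_outcome t ht] at h1
  exact ae_of_ae_map hXt.aemeasurable h1

end IsCMOSSRun

/-! ### Regret decomposition and its two expectations. -/

namespace IsCMOSSRun

variable {m : ℕ} {Ω : Type*} [mΩ : MeasurableSpace Ω] {P : Measure Ω}
  {form : Form} {D : Fin m → Measure ℝ} [∀ i, IsProbabilityMeasure (D i)]
  {σ : ℕ → Finset (Fin m) → Equiv.Perm (Fin m)}
  {𝒜 : Finset (Finset (Fin m))} {δ : ℝ} {T : ℕ} {ℱ : Filtration ℕ mΩ}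
  {X : ℕ → Ω → Fin m → ℝ} {A : ℕ → Ω → Finset (Fin m)}

/-- The expected underestimation of a mean is of order `√δ`. -/
theorem lintegral_underestimation_le [IsProbabilityMeasure P]
    (h : IsCMOSSRun P form D σ 𝒜 δ T ℱ X A)
    (hD : ∀ i, ∀ᵐ y ∂(D i), y ∈ Set.Icc (0 : ℝ) 1) (hδ : 0 < δ) (i : Fin m) {t : ℕ} (ht : t < T) :
    ∫⁻ ω, ENNReal.ofReal (means D i - ucb δ (runStats form σ X A t ω) i) ∂P
      ≤ ENNReal.ofReal (640 * Real.sqrt δ) := by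
  -- Underestimation is an upward deviation of the negated sum. An unobserved arm has optimistic
  -- mean `1` and is never underestimated.
  obtain ⟨Z, hZ, hZi⟩ := (h.isCenteredSum hD i).neg.exists_excess_le hδ
  refine (lintegral_mono fun ω => ?_).trans hZi
  have hμ := (means_mem D hD i).2
  rw [ucb]
  split_ifs with h0
  · rw [ENNReal.ofReal_of_nonpos (by linarith)]; exact zero_le
  · refine le_trans ?_ (hZ t ht.le ω (Nat.one_le_iff_ne_zero.2 h0))
    rw [mean_eq (D := D) i t ω (Nat.one_le_iff_ne_zero.2 h0), ← radius, neg_div]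
    set y := centeredSum form D σ X A i t ω / ((runStats form σ X A t ω).count i : ℝ)
    set ρ := radius δ ((runStats form σ X A t ω).count i)
    rcases le_total (means D i + y + ρ) 1 with hc | hc
    · rw [min_eq_left hc]; exact ENNReal.ofReal_le_ofReal (by linarith)
    · rw [min_eq_right hc, ENNReal.ofReal_of_nonpos (by linarith)]; exact zero_le

open Classical in
/-- The expected overestimation of a mean, summed over the observations of the arm. -/
theorem sum_lintegral_overestimation_le [IsProbabilityMeasure P]
    (h : IsCMOSSRun P form D σ 𝒜 δ T ℱ X A)
    (hD : ∀ i, ∀ᵐ y ∂(D i), y ∈ Set.Icc (0 : ℝ) 1) (hδ : 0 < δ) (i : Fin m) :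
    ∑ t ∈ Finset.range T, ∫⁻ ω, (if i ∈ triggered form (σ t (A t ω)) (A t ω) (X t ω) then
        ENNReal.ofReal (ucb δ (runStats form σ X A t ω) i - means D i) else 0) ∂P
      ≤ ENNReal.ofReal (Real.sqrt δ) * ∫⁻ ω, ((runStats form σ X A T ω).count i : ENNReal) ∂P
        + ENNReal.ofReal (13 / Real.sqrt δ) := by
  have hS := h.isCenteredSum hD i
  set N : ℕ → Ω → ℕ := fun t ω => (runStats form σ X A t ω).count i with hN
  set M := centeredSum form D σ X A i with hM
  have hd : 0 < Real.sqrt δ := Real.sqrt_pos.2 hδ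
  -- The value at `0` pays for the first observation, where the overestimation is at most `1 ≤ √δ +
  -- 1 / √δ`. The constant `13` is `8` for the radii, `1` for this term and `4` for the deviations
  -- beyond `√δ`.
  set φ : ℕ → ℝ := fun s => if s = 0 then 1 / Real.sqrt δ else radius δ s with hφ
  have hφ0 : ∀ s, 0 ≤ φ s := fun s => by
    simp only [hφ]; split_ifs
    · positivity
    · exact radius_nonneg _ _
  have hφsum : ∀ n, ∑ s ∈ Finset.range n, ENNReal.ofReal (φ s) ≤
      ENNReal.ofReal (9 / Real.sqrt δ) := fun n => by
    rw [← ENNReal.ofReal_sum_of_nonneg fun s _ => hφ0 s]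
    refine ENNReal.ofReal_le_ofReal ?_
    refine (Finset.sum_le_sum_of_subset_of_nonneg (Finset.range_mono (Nat.le_succ n))
      fun s _ _ => hφ0 s).trans ?_
    rw [Finset.sum_range_succ']
    have := sum_radius_le hδ n
    simp only [hφ, Nat.add_eq_zero_iff, one_ne_zero, and_false, if_false, if_true]
    have e : 9 / Real.sqrt δ = 8 / Real.sqrt δ + 1 / Real.sqrt δ := by ring
    linarith
  have hNm : Measurable (N T) := (h.measurable_count i T le_rfl).mono (ℱ.le T) le_rfl
  have hNm' : Measurable fun ω => (N T ω : ENNReal) :=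
    (measurable_from_top (f := fun n : ℕ => (n : ENNReal))).comp hNm
  have hpt : ∀ t ω, (if i ∈ triggered form (σ t (A t ω)) (A t ω) (X t ω) then
        ENNReal.ofReal (ucb δ (runStats form σ X A t ω) i - means D i) else 0) ≤
      ((if N (t + 1) ω = N t ω + 1 then ENNReal.ofReal (Real.sqrt δ) else 0) +
        (if N (t + 1) ω = N t ω + 1 then ENNReal.ofReal (φ (N t ω)) else 0)) +
      (if 1 ≤ N t ω ∧ N (t + 1) ω = N t ω + 1 then
        ENNReal.ofReal (M t ω / N t ω - Real.sqrt δ) else 0) := fun t ω => by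
    split_ifs with h1 h2 h3 h3
    · rw [← ENNReal.ofReal_add hd.le (hφ0 _)]
      refine le_trans (ENNReal.ofReal_le_ofReal ?_) ENNReal.ofReal_add_le
      have hc : (runStats form σ X A t ω).count i ≠ 0 := Nat.one_le_iff_ne_zero.1 h3.1
      have hc' : N t ω ≠ 0 := hc
      rw [ucb, if_neg hc, mean_eq (D := D) i t ω h3.1, ← radius]
      simp only [hφ, if_neg hc']
      refine (sub_le_sub_right (min_le_left _ _) _).trans ?_
      linarith
    · have hc' : N t ω = 0 := by
        by_contra hc
        exact h3 ⟨Nat.one_le_iff_ne_zero.2 hc, h2⟩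
      have hc : (runStats form σ X A t ω).count i = 0 := hc'
      rw [add_zero, ← ENNReal.ofReal_add hd.le (hφ0 _)]
      refine ENNReal.ofReal_le_ofReal ?_
      rw [ucb, if_pos hc]
      simp only [hφ, if_pos hc']
      have hμ := (means_mem D hD i).1
      have e : 1 ≤ Real.sqrt δ + 1 / Real.sqrt δ := by
        rcases le_total 1 (Real.sqrt δ) with h4 | h4
        · have : 0 < 1 / Real.sqrt δ := by positivity
          linarith
        · have : 1 ≤ 1 / Real.sqrt δ := by rw [le_div_iff₀ hd]; linarith
          linarith
      linarith
    · exact absurd (by simp only [hN]; rw [runStats_count_succ, if_pos h1]) h2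
    · exact absurd (by simp only [hN]; rw [runStats_count_succ, if_pos h1]) h2
    all_goals exact zero_le
  calc _ = ∫⁻ ω, ∑ t ∈ Finset.range T,
        (if i ∈ triggered form (σ t (A t ω)) (A t ω) (X t ω) then
        ENNReal.ofReal (ucb δ (runStats form σ X A t ω) i - means D i) else 0) ∂P := by
        refine (lintegral_finsetSum _ fun t ht => ?_).symm
        have ht' := Finset.mem_range.1 ht
        refine Measurable.ite (ℱ.le _ _ (h.measurableSet_triggered i t ht')) ?_ measurable_const
        exact (((h.measurable_ucb i t ht'.le).mono (ℱ.le t) le_rfl).sub_const _).ennreal_ofReal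
    _ ≤ ∫⁻ ω, (ENNReal.ofReal (Real.sqrt δ) * N T ω + ENNReal.ofReal (9 / Real.sqrt δ)) +
        ∑ t ∈ Finset.range T, (if 1 ≤ N t ω ∧ N (t + 1) ω = N t ω + 1 then
        ENNReal.ofReal (M t ω / N t ω - Real.sqrt δ) else 0) ∂P := by
        refine lintegral_mono fun ω => ?_
        refine (Finset.sum_le_sum fun t _ => hpt t ω).trans ?_
        rw [Finset.sum_add_distrib, Finset.sum_add_distrib,
          hS.sum_observed_eq (fun _ => ENNReal.ofReal (Real.sqrt δ)) T le_rfl,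
          hS.sum_observed_eq (fun s => ENNReal.ofReal (φ s)) T le_rfl]
        gcongr
        · simp [mul_comm]
        · exact hφsum _
    _ = ENNReal.ofReal (Real.sqrt δ) * ∫⁻ ω, (N T ω : ENNReal) ∂P +
        ENNReal.ofReal (9 / Real.sqrt δ) +
        ∫⁻ ω, ∑ t ∈ Finset.range T, (if 1 ≤ N t ω ∧ N (t + 1) ω = N t ω + 1 then
        ENNReal.ofReal (M t ω / N t ω - Real.sqrt δ) else 0) ∂P := by
        rw [lintegral_add_left ((hNm'.const_mul _).add_const _), lintegral_add_right _
          measurable_const, lintegral_const_mul _ hNm']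
        simp
    _ ≤ ENNReal.ofReal (Real.sqrt δ) * ∫⁻ ω, (N T ω : ENNReal) ∂P +
        ENNReal.ofReal (9 / Real.sqrt δ) + ENNReal.ofReal (4 / Real.sqrt δ) := by
        gcongr
        exact hS.lintegral_sum_excess_le hd
    _ = _ := by
        rw [add_assoc, ← ENNReal.ofReal_add (by positivity) (by positivity)]
        congr 2; ring

open Classical in
/-- The expected overestimation of the means of the played arms. -/
theorem pStar_mul_sum_lintegral_le [IsProbabilityMeasure P]
    (h : IsCMOSSRun P form D σ 𝒜 δ T ℱ X A)
    (hD : ∀ i, ∀ᵐ y ∂(D i), y ∈ Set.Icc (0 : ℝ) 1) (hδ : 0 < δ) {k : ℕ}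
    (hk : ∀ B ∈ 𝒜, B.card ≤ k) :
    ENNReal.ofReal (pStar form D σ 𝒜 T) * ∑ t ∈ Finset.range T, ∑ i, ∫⁻ ω, (if i ∈ A t ω then
      ENNReal.ofReal (ucb δ (runStats form σ X A t ω) i - means D i) else 0) ∂P ≤
    ENNReal.ofReal (Real.sqrt δ * (k * T) + m * (13 / Real.sqrt δ)) := by
  have hd : 0 < Real.sqrt δ := Real.sqrt_pos.2 hδ
  have hNm : ∀ i, Measurable fun ω => ((runStats form σ X A T ω).count i : ENNReal) := fun i =>
    (measurable_from_top (f := fun n : ℕ => (n : ENNReal))).comp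
      ((h.measurable_count i T le_rfl).mono (ℱ.le T) le_rfl)
  calc _ ≤ ∑ t ∈ Finset.range T, ∑ i, ∫⁻ ω,
        (if i ∈ triggered form (σ t (A t ω)) (A t ω) (X t ω) then
        ENNReal.ofReal (ucb δ (runStats form σ X A t ω) i - means D i) else 0) ∂P := by
        rw [Finset.mul_sum]
        refine Finset.sum_le_sum fun t ht => ?_
        rw [Finset.mul_sum]
        have ht' := Finset.mem_range.1 ht
        exact Finset.sum_le_sum fun i _ => h.pStar_mul_lintegral_le ht'
          ((h.measurable_ucb i t ht'.le).sub_const _).ennreal_ofReal i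
    _ ≤ ∑ i, (ENNReal.ofReal (Real.sqrt δ) *
          ∫⁻ ω, ((runStats form σ X A T ω).count i : ENNReal) ∂P
        + ENNReal.ofReal (13 / Real.sqrt δ)) := by
        rw [Finset.sum_comm]
        exact Finset.sum_le_sum fun i _ => h.sum_lintegral_overestimation_le hD hδ i
    _ = ENNReal.ofReal (Real.sqrt δ) *
          ∫⁻ ω, ∑ i, ((runStats form σ X A T ω).count i : ENNReal) ∂P
        + m * ENNReal.ofReal (13 / Real.sqrt δ) := by
        rw [Finset.sum_add_distrib, ← Finset.mul_sum, lintegral_finsetSum _ fun i _ => hNm i]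
        simp
    _ ≤ ENNReal.ofReal (Real.sqrt δ) * ((k * T : ℕ) : ENNReal)
        + m * ENNReal.ofReal (13 / Real.sqrt δ) := by
        gcongr
        calc _ ≤ ∫⁻ _, ((k * T : ℕ) : ENNReal) ∂P := by
              refine lintegral_mono fun ω => ?_
              rw [← Nat.cast_sum, Nat.cast_le]
              exact h.sum_count_le hk ω T le_rfl
          _ = _ := by simp
    _ = _ := by
        rw [ENNReal.ofReal_add (by positivity) (by positivity), ENNReal.ofReal_mul hd.le,
          ENNReal.ofReal_mul (p := (m : ℝ)) (by positivity), ← Nat.cast_mul,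
          ENNReal.ofReal_natCast, ENNReal.ofReal_natCast]

open Classical in
-- Optimism: pass from `μ` to `μ̄` on `A*`, from `A*` to `A_t` by maximality, and back to `μ` on
-- `A_t`. Outcomes in `[0, 1]` keep `μ̄` in the range where the reward is Lipschitz, whence the
-- almost sure statement.
theorem ae_regret_le (h : IsCMOSSRun P form D σ 𝒜 δ T ℱ X A)
    (hD : ∀ i, ∀ᵐ y ∂(D i), y ∈ Set.Icc (0 : ℝ) 1) {Astar : Finset (Fin m)} (hA : Astar ∈ 𝒜) :
    ∀ᵐ ω ∂P, ENNReal.ofReal (∑ t ∈ Finset.range T,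
        (reward form Astar (means D) - reward form (A t ω) (means D))) ≤
      (∑ t ∈ Finset.range T, ∑ i ∈ Astar,
        ENNReal.ofReal (means D i - ucb δ (runStats form σ X A t ω) i)) +
      ∑ t ∈ Finset.range T, ∑ i, (if i ∈ A t ω then
        ENNReal.ofReal (ucb δ (runStats form σ X A t ω) i - means D i) else 0) := by
  filter_upwards [h.ae_outcome_mem hD] with ω hω
  have e : ∀ x : ℝ, ENNReal.ofReal x = ENNReal.ofReal (max x 0) := fun x => by simp
  rw [← Finset.sum_add_distrib]
  have hpos : ∀ t, (∑ i ∈ Astar, ENNReal.ofReal (means D i - ucb δ (runStats form σ X A t ω) i)) +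
      ∑ i, (if i ∈ A t ω then
        ENNReal.ofReal (ucb δ (runStats form σ X A t ω) i - means D i) else 0) =
      ENNReal.ofReal ((∑ i ∈ Astar, max (means D i - ucb δ (runStats form σ X A t ω) i) 0) +
        ∑ i ∈ A t ω, max (ucb δ (runStats form σ X A t ω) i - means D i) 0) := fun t => by
    rw [ENNReal.ofReal_add (Finset.sum_nonneg fun i _ => le_max_right _ _)
      (Finset.sum_nonneg fun i _ => le_max_right _ _),
      ENNReal.ofReal_sum_of_nonneg fun i _ => le_max_right _ _,
      ENNReal.ofReal_sum_of_nonneg fun i _ => le_max_right _ _]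
    simp_rw [← e]
    congr 1
    simp
  simp_rw [hpos]
  rw [← ENNReal.ofReal_sum_of_nonneg fun t _ => add_nonneg
    (Finset.sum_nonneg fun i _ => le_max_right _ _)
    (Finset.sum_nonneg fun i _ => le_max_right _ _)]
  refine ENNReal.ofReal_le_ofReal (Finset.sum_le_sum fun t ht => ?_)
  have ht' := Finset.mem_range.1 ht
  have hu : ∀ i, ucb δ (runStats form σ X A t ω) i ∈ Set.Icc (0 : ℝ) 1 := fun i =>
    ucb_mem δ _ i (mean_mem ω hω t ht'.le i).1
  have hμ := means_mem D hD
  have h1 := reward_sub_reward_le form Astar _ _ hμ hu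
  have h2 := reward_sub_reward_le form (A t ω) _ _ hu hμ
  have h3 : reward form Astar (ucb δ (runStats form σ X A t ω)) ≤
      reward form (A t ω) (ucb δ (runStats form σ X A t ω)) := h.action_argmax t ht' ω hA
  linarith

theorem expectedRegret_le [IsProbabilityMeasure P]
    (h : IsCMOSSRun P form D σ 𝒜 δ T ℱ X A)
    (hD : ∀ i, ∀ᵐ y ∂(D i), y ∈ Set.Icc (0 : ℝ) 1) (hδ : 0 < δ) {k : ℕ}
    (hk : ∀ B ∈ 𝒜, B.card ≤ k) {Astar : Finset (Fin m)} (hA : Astar ∈ 𝒜)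
    (hmax : IsMaxOn (fun B => reward form B (means D)) ↑𝒜 Astar)
    (hp : 0 < pStar form D σ 𝒜 T) :
    expectedRegret P form D T Astar A ≤ T * (k * (640 * Real.sqrt δ)) +
      (Real.sqrt δ * (k * T) + m * (13 / Real.sqrt δ)) / pStar form D σ 𝒜 T := by
  classical
  set p := pStar form D σ 𝒜 T with hpdef
  set R : Ω → ℝ := fun ω => ∑ t ∈ Finset.range T,
    (reward form Astar (means D) - reward form (A t ω) (means D)) with hR
  have hd : 0 < Real.sqrt δ := Real.sqrt_pos.2 hδ
  have hRHS : 0 ≤ T * (k * (640 * Real.sqrt δ)) +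
      (Real.sqrt δ * (k * T) + m * (13 / Real.sqrt δ)) / p := by positivity
  have hR0 : ∀ ω, 0 ≤ R ω := fun ω => Finset.sum_nonneg fun t ht =>
    sub_nonneg.2 (hmax (h.action_mem t (Finset.mem_range.1 ht) ω))
  change ∫ ω, R ω ∂P ≤ _
  by_cases hint : Integrable R P
  swap
  -- The integral of a non-integrable function is `0` by convention, which is below the nonnegative
  -- bound.
  · rw [integral_undef hint]; exact hRHS
  rw [← ENNReal.ofReal_le_ofReal_iff hRHS,
    ofReal_integral_eq_lintegral_ofReal hint (Filter.Eventually.of_forall hR0)]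
  have hum : ∀ t < T, ∀ i, Measurable fun ω => ucb δ (runStats form σ X A t ω) i :=
    fun t ht i => (h.measurable_ucb i t ht.le).mono (ℱ.le t) le_rfl
  have hm1 : ∀ t ∈ Finset.range T, ∀ i, Measurable fun ω =>
      ENNReal.ofReal (means D i - ucb δ (runStats form σ X A t ω) i) := fun t ht i =>
    ((hum t (Finset.mem_range.1 ht) i).const_sub _).ennreal_ofReal
  have hm2 : ∀ t ∈ Finset.range T, ∀ i, Measurable fun ω => (if i ∈ A t ω then
      ENNReal.ofReal (ucb δ (runStats form σ X A t ω) i - means D i) else 0) := fun t ht i => by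
    have ht' := Finset.mem_range.1 ht
    refine Measurable.ite ?_ ((hum t ht' i).sub_const _).ennreal_ofReal measurable_const
    have : {ω | i ∈ A t ω} = ⋃ B ∈ {B : Finset (Fin m) | i ∈ B}, {ω | A t ω = B} := by
      ext ω; simp
    rw [this]
    exact MeasurableSet.biUnion (Set.to_countable _) fun B _ =>
      ℱ.le t _ (h.measurable_action t ht' B)
  have hE1 : ∑ t ∈ Finset.range T, ∑ i ∈ Astar, ∫⁻ ω,
      ENNReal.ofReal (means D i - ucb δ (runStats form σ X A t ω) i) ∂P ≤
      ENNReal.ofReal (T * (k * (640 * Real.sqrt δ))) := by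
    calc _ ≤ ∑ t ∈ Finset.range T, ∑ i ∈ Astar, ENNReal.ofReal (640 * Real.sqrt δ) :=
          Finset.sum_le_sum fun t ht => Finset.sum_le_sum fun i _ =>
            h.lintegral_underestimation_le hD hδ i (Finset.mem_range.1 ht)
      _ = T * (Astar.card * ENNReal.ofReal (640 * Real.sqrt δ)) := by simp
      _ ≤ T * (k * ENNReal.ofReal (640 * Real.sqrt δ)) := by
          gcongr
          exact hk _ hA
      _ = _ := by
          rw [ENNReal.ofReal_mul (p := (T : ℝ)) (by positivity),
            ENNReal.ofReal_mul (p := (k : ℝ)) (by positivity), ENNReal.ofReal_natCast,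
            ENNReal.ofReal_natCast]
  have hE2 : ∑ t ∈ Finset.range T, ∑ i, ∫⁻ ω, (if i ∈ A t ω then
      ENNReal.ofReal (ucb δ (runStats form σ X A t ω) i - means D i) else 0) ∂P ≤
      ENNReal.ofReal ((Real.sqrt δ * (k * T) + m * (13 / Real.sqrt δ)) / p) := by
    rw [ENNReal.ofReal_div_of_pos hp, ENNReal.le_div_iff_mul_le
      (Or.inl (ENNReal.ofReal_pos.2 hp).ne') (Or.inl ENNReal.ofReal_ne_top), mul_comm]
    exact h.pStar_mul_sum_lintegral_le hD hδ hk
  refine (lintegral_mono_ae (h.ae_regret_le hD hA)).trans ?_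
  rw [lintegral_add_left (Finset.measurable_sum _ fun t ht => Finset.measurable_sum _ fun i _ =>
      hm1 t ht i),
    lintegral_finsetSum _ fun t ht => Finset.measurable_sum _ fun i _ => hm1 t ht i,
    lintegral_finsetSum _ fun t ht => Finset.measurable_sum _ fun i _ => hm2 t ht i,
    Finset.sum_congr rfl fun t ht => lintegral_finsetSum _ fun i _ => hm1 t ht i,
    Finset.sum_congr (g := fun t => ∑ i, ∫⁻ ω, (if i ∈ A t ω then
      ENNReal.ofReal (ucb δ (runStats form σ X A t ω) i - means D i) else 0) ∂P) rfl
      fun t ht => lintegral_finsetSum _ fun i _ => hm2 t ht i,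
    ENNReal.ofReal_add (by positivity) (by positivity)]
  exact add_le_add hE1 hE2

end IsCMOSSRun

theorem pStar_le_one {m : ℕ} (form : Form) (D : Fin m → Measure ℝ)
    [∀ i, IsProbabilityMeasure (D i)] (σ : ℕ → Finset (Fin m) → Equiv.Perm (Fin m))
    {𝒜 : Finset (Finset (Fin m))} {T : ℕ} (hT : 1 ≤ T) {B : Finset (Fin m)} (hB : B ∈ 𝒜) :
    pStar form D σ 𝒜 T ≤ 1 :=
  (pStar_le form D (t := 0) (by omega) hB).trans measureReal_le_one

end Cascading

/-! ### Choice of `δ` and conclusion. -/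

theorem theorem2 :
    ∃ C : ℝ, 0 < C ∧
      ∀ (form : Cascading.Form) (m k T : ℕ), 1 ≤ m → 1 ≤ k → 1 ≤ T →
      ∀ (D : Fin m → Measure ℝ), (∀ i, IsProbabilityMeasure (D i)) →
        (∀ i, ∀ᵐ y ∂(D i), y ∈ Set.Icc (0 : ℝ) 1) →
      ∀ (𝒜 : Finset (Finset (Fin m))), (∀ A ∈ 𝒜, A.card ≤ k) →
      ∀ (σ : ℕ → Finset (Fin m) → Equiv.Perm (Fin m)),
        0 < Cascading.pStar form D σ 𝒜 T →
      ∀ (Ω : Type*) [mΩ : MeasurableSpace Ω] (P : Measure Ω) [IsProbabilityMeasure P]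
        (ℱ : Filtration ℕ mΩ) (X : ℕ → Ω → Fin m → ℝ) (A : ℕ → Ω → Finset (Fin m)),
        Cascading.IsCMOSSRun P form D σ 𝒜 ((m : ℝ) / ((k : ℝ) * (T : ℝ))) T ℱ X A →
      ∀ Astar ∈ 𝒜,
        IsMaxOn (fun B => Cascading.reward form B (Cascading.means D)) ↑𝒜 Astar →
        Cascading.expectedRegret P form D T Astar A ≤
          C * ((max 1 (Real.logb 2 (k : ℝ))) ^ 2 / Cascading.pStar form D σ 𝒜 T) *
            Real.sqrt ((k : ℝ) * (m : ℝ) * (T : ℝ)) := by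
  -- `654 = 640 + 1 + 13`; the first term carries no `1 / p*` and is enlarged using `p* ≤ 1`.
  refine ⟨654, by norm_num, ?_⟩
  intro form m k T hm hk hT D hDp hD 𝒜 hcard σ hp Ω mΩ P hP ℱ X A h Astar hA hmax
  have hm0 : (0 : ℝ) < m := by exact_mod_cast hm
  have hk0 : (0 : ℝ) < k := by exact_mod_cast hk
  have hT0 : (0 : ℝ) < T := by exact_mod_cast hT
  have hmain := h.expectedRegret_le hD (by positivity) hcard hA hmax hp
  have hp1 := Cascading.pStar_le_one form D σ hT hA
  set p := Cascading.pStar form D σ 𝒜 T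
  set S := Real.sqrt ((k : ℝ) * m * T) with hS
  have hd : Real.sqrt ((m : ℝ) / (k * T)) * (k * T) = S := by
    rw [hS, show (k : ℝ) * m * T = m / (k * T) * (k * T) ^ 2 by field_simp,
      Real.sqrt_mul (by positivity), Real.sqrt_sq (by positivity)]
  have hd0 : 0 < Real.sqrt ((m : ℝ) / (k * T)) := by positivity
  have hd2 : Real.sqrt ((m : ℝ) / (k * T)) ^ 2 = m / (k * T) := Real.sq_sqrt (by positivity)
  have hdm : (m : ℝ) * (13 / Real.sqrt ((m : ℝ) / (k * T))) = 13 * S := by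
    rw [← hd]
    have : (m : ℝ) = Real.sqrt ((m : ℝ) / (k * T)) ^ 2 * (k * T) := by rw [hd2]; field_simp
    generalize Real.sqrt ((m : ℝ) / (k * T)) = d at *
    rw [this]; field_simp
  have hd1 : (T : ℝ) * (k * (640 * Real.sqrt ((m : ℝ) / (k * T)))) = 640 * S := by
    rw [← hd]; ring
  rw [hd, hdm, hd1] at hmain
  have hS0 : 0 ≤ S := Real.sqrt_nonneg _
  refine hmain.trans ?_
  have hlog : 1 ≤ max 1 (Real.logb 2 (k : ℝ)) ^ 2 := one_le_pow₀ (le_max_left _ _)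
  calc 640 * S + (S + 13 * S) / p ≤ 640 * S / p + (S + 13 * S) / p := by
        gcongr
        exact le_div_self (by positivity) hp hp1
    _ = 654 * (1 / p) * S := by ring
    _ ≤ _ := by gcongr
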